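/- Let $X$ be a compact connected Riemann surface, $x\in X$ a point, $r\ge 3$ an integer and $n=\lfloor r/2\rfloor$. An orthogonal bundle of rank $r$ with values in a holomorphic line bundle $L$ is a holomorphic vector bundle $E$ of rank $r$ on $X$ with a holomorphic symmetric form $\varphi:E\otimes E\to L$ that is nondegenerate on every fibre. For a vector bundle $G$ with a symmetric form, a subbundle $H\subset G$ is isotropic if the form vanishes identically on $H\otimes H$; $(G,\cdot)$ is $(k,l)$-stable if $$\frac{\deg H+k}{\operatorname{rk}H}<\frac{\deg G+k-l}{\operatorname{rk}G}$$ for all isotropic subbundles $H$ of positive rank. An orthogonal bundle is stable if $\deg H/\operatorname{rk}H<\deg G/\operatorname{rk}G$ for all isotropic subbundles $H\neq 0$. Let $(E,\varphi:E\otimes E\to L)$ be an $(n,n)$-stable orthogonal bundle of rank $r$. First Hecke transform. Let $\varphi^{-1}:E^\vee\otimes E^\vee\to L^\vee$ be the inverse form, let $W\subset E_x^\vee$ be a $\varphi^{-1}$-isotropic subspace of dimension $n$, and let $W^\perp\subset E_x^\vee$ be its annihilator with respect to $\varphi^{-1}$ (so $W^\perp=W$ if $r=2n$, and $\dim W^\perp=n+1$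 if $r=2n+1$). Define $F$ by $$0\to F^\vee\to E^\vee\to E_x^\vee/W^\perp\to 0 ,$$ so that $E\subset F\subset E(x)$. Let $\psi:F\otimes F\to L(x)$ be the symmetric form given by the meromorphic extension of $\varphi$. Second Hecke transform. Let $l_x\subset F_x$ be the kernel of the form $\psi_x$ on the fibre $F_x$ ($l_x=0$ if $r$ is even, $\dim l_x=1$ if $r$ is odd), let $S\subset F_x/l_x$ be an isotropic subspace of dimension $n$, and define $E'$ by $$0\to E'\to F\to (F_x/l_x)/S\to 0 .$$ Then $E'$ is a holomorphic vector bundle of rank $r$, the restriction $\varphi'$ of $\psi$ to $E'$ takes values in $L(x)(-x)=L$, and $(E',\varphi':E'\otimes E'\to L)$ is a stable orthogonal bundle. -/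

import Mathlib

open scoped Manifold ContDiff Topology
open Bundle Filter

universe u v w

/-- A holomorphic vector bundle of rank `r` on a complex manifold `X` of dimension one:
a vector bundle in Mathlib's sense with fibre `ℂ ^ r` and holomorphic transition functions. -/
structure HolVectorBundle (X : Type u) [TopologicalSpace X] [ChartedSpace ℂ X] (r : ℕ) where
  fiber : X → Type v
  [addCommGroup : ∀ q, AddCommGroup (fiber q)]
  [module : ∀ q, Module ℂ (fiber q)]
  [fiberTopology : ∀ q, TopologicalSpace (fiber q)]
  [totalTopology : TopologicalSpace (TotalSpace (Fin r → ℂ) fiber)]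
  [fiberBundle : FiberBundle (Fin r → ℂ) fiber]
  [vectorBundle : VectorBundle ℂ (Fin r → ℂ) fiber]
  [holomorphic : ContMDiffVectorBundle ω (Fin r → ℂ) fiber 𝓘(ℂ)]

attribute [instance] HolVectorBundle.addCommGroup HolVectorBundle.module
  HolVectorBundle.fiberTopology HolVectorBundle.totalTopology HolVectorBundle.fiberBundle
  HolVectorBundle.vectorBundle HolVectorBundle.holomorphic

namespace Hecke

noncomputable section

variable {X : Type u} [TopologicalSpace X] [ChartedSpace ℂ X] {r : ℕ}

/-! ### Functions and sections -/

/-- The local coordinate centred at `p` (only its germ at `p` matters). -/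
def coord (p : X) : X → ℂ := fun y => chartAt ℂ p y - chartAt ℂ p p

/-- `f` is holomorphic in a neighbourhood of `p`. -/
def HolFun (f : X → ℂ) (p : X) : Prop := ContMDiffAt 𝓘(ℂ) 𝓘(ℂ) ω f p

theorem holFun_coord [IsManifold 𝓘(ℂ) ω X] (p : X) : HolFun (coord p) p :=
  ContMDiffAt.sub
    (contMDiffAt_of_mem_maximalAtlas (IsManifold.chart_mem_maximalAtlas p) (mem_chart_source ℂ p))
    contMDiffAt_const

/-- `f` is a meromorphic function near `p`. -/
def MeroFun (f : X → ℂ) (p : X) : Prop :=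
  MeromorphicAt (f ∘ (chartAt ℂ p).symm) (chartAt ℂ p p)

/-- The order at `p` of a function that is meromorphic near `p` (`⊤` for the zero germ). -/
def ordFun (f : X → ℂ) (p : X) : WithTop ℤ :=
  meromorphicOrderAt (f ∘ (chartAt ℂ p).symm) (chartAt ℂ p p)

/-- Set-theoretic sections of `E`.  Below only germs of such sections in punctured neighbourhoods
of points are used, so that meromorphic sections may have any values at their poles. -/
abbrev Sec (E : HolVectorBundle.{u, v} X r) : Type max u v := ∀ q : X, E.fiber q

/-- The section `s` of `E` is holomorphic in a neighbourhood of `p`. -/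
def HolSec (E : HolVectorBundle.{u, v} X r) (s : Sec E) (p : X) : Prop :=
  ContMDiffAt 𝓘(ℂ) (𝓘(ℂ).prod 𝓘(ℂ, Fin r → ℂ)) ω
    (fun q => TotalSpace.mk' (Fin r → ℂ) q (s q)) p

/-- A family of stalks inside the stalks `𝓜(E)_p` of the sheaf of meromorphic sections of `E`:
`s ∈ 𝓖 p` means that the germ of `s` at `p` lies in the stalk `𝓖_p`.  All families used below are
invariant under changing `s` outside a punctured neighbourhood of `p`. A locally free subsheaf of
`𝓜(E)` is given by its stalks; see `IsLocallyFree`. -/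
abbrev SubSheaf (E : HolVectorBundle.{u, v} X r) : Type max u v := X → Submodule ℂ (Sec E)

/-- The sheaf of holomorphic sections of `E`. -/
def holSheaf (E : HolVectorBundle.{u, v} X r) : SubSheaf E := fun p =>
  { carrier := {s | ∃ u : Sec E, HolSec E u p ∧ ∀ᶠ y in 𝓝[≠] p, s y = u y}
    zero_mem' := ⟨0, by
      have h : ContMDiff 𝓘(ℂ) (𝓘(ℂ).prod 𝓘(ℂ, Fin r → ℂ)) ω (zeroSection (Fin r → ℂ) E.fiber) :=
        contMDiff_zeroSection ℂ E.fiber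
      exact h p, Eventually.of_forall fun _ => rfl⟩
    add_mem' := by
      rintro s t ⟨u, hu, hsu⟩ ⟨v, hv, htv⟩
      refine ⟨u + v, ContMDiffAt.add_section hu hv, ?_⟩
      filter_upwards [hsu, htv] with y h1 h2
      simp [h1, h2]
    smul_mem' := by
      rintro c s ⟨u, hu, hsu⟩
      refine ⟨c • u, ContMDiffAt.const_smul_section hu, ?_⟩
      filter_upwards [hsu] with y h1
      simp [h1] }

/-- The section `s` of `E` is meromorphic near `p`. -/
def MeroSec (E : HolVectorBundle.{u, v} X r) (s : Sec E) (p : X) : Prop :=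
  ∃ N : ℕ, (fun q => coord p q ^ N • s q) ∈ holSheaf E p

/-- `𝔪_p 𝓖_p`: the germs of `𝓖` at `p` that vanish at `p`. -/
def vanishing {E : HolVectorBundle.{u, v} X r} (𝓖 : SubSheaf E) (p : X) : Submodule ℂ (Sec E) where
  carrier := {s | ∃ u ∈ 𝓖 p, ∀ᶠ y in 𝓝[≠] p, s y = coord p y • u y}
  zero_mem' := ⟨0, (𝓖 p).zero_mem, Eventually.of_forall fun _ => by simp⟩
  add_mem' := by
    rintro s t ⟨u, hu, hsu⟩ ⟨v, hv, htv⟩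
    refine ⟨u + v, (𝓖 p).add_mem hu hv, ?_⟩
    filter_upwards [hsu, htv] with y h1 h2
    simp [h1, h2]
  smul_mem' := by
    rintro c s ⟨u, hu, hsu⟩
    refine ⟨c • u, (𝓖 p).smul_mem c hu, ?_⟩
    filter_upwards [hsu] with y h1
    rw [Pi.smul_apply, Pi.smul_apply, h1]
    exact smul_comm _ _ _

open Classical in
/-- The twist `𝓖(x) = 𝓖 ⊗ 𝒪(x)`: a simple pole is allowed at `x`. -/
def twist {E : HolVectorBundle.{u, v} X r} (𝓖 : SubSheaf E) (x : X) : SubSheaf E := fun p =>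
  if p = x then
    { carrier := {s | (fun q => coord x q • s q) ∈ 𝓖 x}
      zero_mem' := by
        have h : (fun q => coord x q • (0 : Sec E) q) = 0 := by funext q; simp
        change _ ∈ 𝓖 x
        rw [h]
        exact (𝓖 x).zero_mem
      add_mem' := by
        intro s t hs ht
        have h : (fun q => coord x q • (s + t) q) =
            (fun q => coord x q • s q) + (fun q => coord x q • t q) := by
          funext q; simp
        change _ ∈ 𝓖 x
        rw [h]
        exact (𝓖 x).add_mem hs ht
      smul_mem' := by
        intro c s hs
        have h : (fun q => coord x q • (c • s) q) = c • (fun q => coord x q • s q) := by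
          funext q; exact smul_comm _ _ _
        change _ ∈ 𝓖 x
        rw [h]
        exact (𝓖 x).smul_mem c hs }
  else 𝓖 p

/-! ### Locally free sheaves, subbundles and degree -/

/-- The meromorphic sections `e i` form a local frame of `𝓖` near `p`: for all `q` close to `p` the
stalk `𝓖_q` is the free `𝒪_q`-module on the germs of the `e i`. -/
def IsFrame {E : HolVectorBundle.{u, v} X r} {ι : Type*} [Fintype ι] (𝓖 : SubSheaf E) (p : X)
    (e : ι → Sec E) : Prop :=
  ∀ᶠ q in 𝓝 p,
    (∀ i, MeroSec E (e i) q) ∧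
    (∀ᶠ y in 𝓝[≠] q, LinearIndependent ℂ fun i => e i y) ∧
    ∀ s : Sec E, s ∈ 𝓖 q ↔
      ∃ f : ι → X → ℂ, (∀ i, HolFun (f i) q) ∧ ∀ᶠ y in 𝓝[≠] q, s y = ∑ i, f i y • e i y

/-- `𝓖` is a locally free subsheaf of rank `k` of the sheaf of meromorphic sections of `E`,
i.e. a holomorphic vector bundle of rank `k`. -/
def IsLocallyFree {E : HolVectorBundle.{u, v} X r} (𝓖 : SubSheaf E) (k : ℕ) : Prop :=
  ∀ p, ∃ e : Fin k → Sec E, IsFrame 𝓖 p e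

/-- `𝓗` is a subbundle of rank `k` of the vector bundle `𝓖`: locally, a frame of `𝓗` can be
completed to a frame of `𝓖`. -/
def IsSubbundle {E : HolVectorBundle.{u, v} X r} (𝓗 𝓖 : SubSheaf E) (k : ℕ) : Prop :=
  ∀ p, ∃ (m : ℕ) (e : Fin k → Sec E) (e' : Fin m → Sec E),
    IsFrame 𝓗 p e ∧ IsFrame 𝓖 p (Sum.elim e e')

/-- `D` is the divisor of the nonzero meromorphic section `s₁ ∧ ⋯ ∧ s_k` of the line bundle
`det 𝓖`, where `𝓖` is locally free of rank `k`: the order at `p` is that of the determinant of the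
matrix that expresses `s₁, …, s_k` through a local frame of `𝓖` at `p`. -/
def IsDivisorOf {E : HolVectorBundle.{u, v} X r} {k : ℕ} (𝓖 : SubSheaf E) (s : Fin k → Sec E)
    (D : X →₀ ℤ) : Prop :=
  ∀ p, ∃ (e : Fin k → Sec E) (a : Fin k → Fin k → X → ℂ),
    IsFrame 𝓖 p e ∧ (∀ i j, MeroFun (a i j) p) ∧
    (∀ i, ∀ᶠ y in 𝓝[≠] p, s i y = ∑ j, a i j y • e j y) ∧
    ordFun (fun y => (Matrix.of fun i j => a i j y).det) p = (D p : WithTop ℤ)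

/-- The degree of a vector bundle `𝓖` of rank `k` on a compact connected Riemann surface: the
degree of the divisor of any nonzero meromorphic section `s₁ ∧ ⋯ ∧ s_k` of `det 𝓖`.  Such sections
exist and their divisors all have the same degree, so that the set below has exactly one element,
its supremum. -/
def degree {E : HolVectorBundle.{u, v} X r} (𝓖 : SubSheaf E) (k : ℕ) : ℤ :=
  sSup {d | ∃ (s : Fin k → Sec E) (D : X →₀ ℤ), IsDivisorOf 𝓖 s D ∧ d = D.sum fun _ m => m}

/-! ### Orthogonal forms -/

/-- A symmetric nondegenerate holomorphic form `φ : E ⊗ E → L` on the vector bundle `E` with values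
in the line bundle `L`; nondegenerate means that `E → E^∨ ⊗ L` is an isomorphism. -/
structure OrthogonalForm (E : HolVectorBundle.{u, v} X r) (L : HolVectorBundle.{u, w} X 1) where
  form : ∀ q, E.fiber q →ₗ[ℂ] E.fiber q →ₗ[ℂ] L.fiber q
  symm : ∀ q a b, form q a b = form q b a
  nondegenerate : ∀ q, Function.Bijective (form q)
  holomorphic : ∀ (p : X) (s t : Sec E), HolSec E s p → HolSec E t p →
    HolSec L (fun q => form q (s q) (t q)) p

variable {E : HolVectorBundle.{u, v} X r} {L : HolVectorBundle.{u, w} X 1}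

namespace OrthogonalForm

/-- The form applied to two (meromorphic) sections. -/
def onSec (φ : OrthogonalForm E L) (s t : Sec E) : Sec L := fun q => φ.form q (s q) (t q)

/-- The inverse form `φ⁻¹ : E_q^∨ ⊗ E_q^∨ → L_q^∨`, the transport of the form `φ` by
`E_q^∨ ≅ E_q ⊗ L_q^∨`.  Explicitly `φ⁻¹(ξ, η)(ℓ) = η(a)` with `a ∈ E_q` given by
`φ(a, ·) = ξ(·) ℓ`. -/
def inverseForm (φ : OrthogonalForm E L) (q : X) (ξ η : Module.Dual ℂ (E.fiber q)) :
    Module.Dual ℂ (L.fiber q) :=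
  η ∘ₗ (LinearEquiv.ofBijective (φ.form q) (φ.nondegenerate q)).symm.toLinearMap ∘ₗ
    LinearMap.smulRightₗ ξ

/-- The annihilator `W^⊥ ⊆ E_q^∨` of `W ⊆ E_q^∨` with respect to the inverse form. -/
def perp (φ : OrthogonalForm E L) (q : X) (W : Submodule ℂ (Module.Dual ℂ (E.fiber q))) :
    Submodule ℂ (Module.Dual ℂ (E.fiber q)) where
  carrier := {η | ∀ ξ ∈ W, φ.inverseForm q ξ η = 0}
  zero_mem' := fun ξ _ => by simp [inverseForm]
  add_mem' := fun {a b} ha hb ξ hξ => by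
    have h1 := ha ξ hξ
    have h2 := hb ξ hξ
    simp only [inverseForm] at h1 h2 ⊢
    rw [LinearMap.add_comp, h1, h2, add_zero]
  smul_mem' := fun c a ha ξ hξ => by
    have h1 := ha ξ hξ
    simp only [inverseForm] at h1 ⊢
    rw [LinearMap.smul_comp, h1, smul_zero]

/-- `W ⊆ E_q^∨` is isotropic for the inverse form. -/
def IsIsotropicDual (φ : OrthogonalForm E L) (q : X)
    (W : Submodule ℂ (Module.Dual ℂ (E.fiber q))) : Prop :=
  ∀ ξ ∈ W, ∀ η ∈ W, φ.inverseForm q ξ η = 0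

/-- The form vanishes identically on the sheaf `𝓗`. -/
def IsIsotropic (φ : OrthogonalForm E L) (𝓗 : SubSheaf E) : Prop :=
  ∀ p, ∀ s ∈ 𝓗 p, ∀ t ∈ 𝓗 p, ∀ᶠ y in 𝓝[≠] p, φ.onSec s t y = 0

/-- `(k, l)`-stability of the bundle `𝓖` (of full rank `r` in `𝓜(E)`), with the bilinear form given
by the meromorphic extension of `φ`. -/
def IsKLStable (φ : OrthogonalForm E L) (𝓖 : SubSheaf E) (k l : ℤ) : Prop :=
  ∀ (j : ℕ) (𝓗 : SubSheaf E), 0 < j → IsSubbundle 𝓗 𝓖 j → φ.IsIsotropic 𝓗 →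
    ((degree 𝓗 j : ℚ) + k) / j < ((degree 𝓖 r : ℚ) + k - l) / r

/-- Stability of an orthogonal bundle: `deg 𝓗 / rk 𝓗 < deg 𝓖 / rk 𝓖` for all isotropic subbundles
`𝓗 ≠ 0` of `𝓖`. -/
def IsStable (φ : OrthogonalForm E L) (𝓖 : SubSheaf E) : Prop :=
  ∀ (j : ℕ) (𝓗 : SubSheaf E), 0 < j → IsSubbundle 𝓗 𝓖 j → φ.IsIsotropic 𝓗 →
    (degree 𝓗 j : ℚ) / j < (degree 𝓖 r : ℚ) / r

/-- The meromorphic extension of `φ` makes `𝓖 ⊆ 𝓜(E)` an orthogonal bundle of rank `r` with values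
in the line bundle `𝓛 ⊆ 𝓜(L)`: `𝓖` is a vector bundle of rank `r`, the form maps `𝓖 ⊗ 𝓖` to `𝓛`,
and it is nondegenerate on each fibre `𝓖_p / 𝔪_p 𝓖_p`.  (Symmetry is part of `φ`.) -/
def IsOrthogonalBundle (φ : OrthogonalForm E L) (𝓖 : SubSheaf E) (𝓛 : SubSheaf L) : Prop :=
  IsLocallyFree 𝓖 r ∧
  (∀ p, ∀ s ∈ 𝓖 p, ∀ t ∈ 𝓖 p, φ.onSec s t ∈ 𝓛 p) ∧
  (∀ p, ∀ s ∈ 𝓖 p, (∀ t ∈ 𝓖 p, φ.onSec s t ∈ vanishing 𝓛 p) → s ∈ vanishing 𝓖 p)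

end OrthogonalForm

/-! ### The two Hecke transforms -/

/-- Germs at `p` of sections of the dual bundle `E^∨`, holomorphic near `p`. -/
def HolDualSec (E : HolVectorBundle.{u, v} X r) (ξ : ∀ q, Module.Dual ℂ (E.fiber q)) (p : X) :
    Prop :=
  ∀ s : Sec E, HolSec E s p → HolFun (fun q => ξ q (s q)) p

/-- The kernel of `E^∨ → E_x^∨ / V`, for a subspace `V` of the fibre `E_x^∨`. -/
def dualKernel (E : HolVectorBundle.{u, v} X r) (x : X)
    (V : Submodule ℂ (Module.Dual ℂ (E.fiber x))) (p : X) :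
    Set (∀ q, Module.Dual ℂ (E.fiber q)) :=
  {ξ | HolDualSec E ξ p ∧ (p = x → ξ x ∈ V)}

/-- The bundle `F ⊇ E` for which `F^∨` is the kernel of `E^∨ → E_x^∨ / V`: its germs at `p` are the
meromorphic sections of `E` on which all germs of `F^∨` at `p` are holomorphic. -/
def heckeUp [IsManifold 𝓘(ℂ) ω X] (E : HolVectorBundle.{u, v} X r) (x : X)
    (V : Submodule ℂ (Module.Dual ℂ (E.fiber x))) : SubSheaf E := fun p =>
  { carrier := {s | MeroSec E s p ∧ ∀ ξ ∈ dualKernel E x V p,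
      ∃ g : X → ℂ, HolFun g p ∧ ∀ᶠ y in 𝓝[≠] p, ξ y (s y) = g y}
    zero_mem' := by
      refine ⟨⟨0, ?_⟩, fun ξ _ => ⟨0, contMDiffAt_const, Eventually.of_forall fun y => by simp⟩⟩
      have h : (fun q => coord p q ^ 0 • (0 : Sec E) q) = 0 := by funext q; simp
      rw [h]
      exact (holSheaf E p).zero_mem
    add_mem' := by
      rintro s t ⟨⟨N, hN⟩, hs⟩ ⟨⟨M, hM⟩, ht⟩
      refine ⟨⟨N + M, ?_⟩, fun ξ hξ => ?_⟩
      · obtain ⟨u, hu, hsu⟩ := hN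
        obtain ⟨v, hv, htv⟩ := hM
        have hc : HolFun (coord p) p := holFun_coord p
        have hc' : ∀ K : ℕ, HolFun (fun q => coord p q ^ K) p := fun K => ContMDiffAt.pow hc K
        refine ⟨(fun q => coord p q ^ M) • u + (fun q => coord p q ^ N) • v,
          ContMDiffAt.add_section (ContMDiffAt.smul_section (hc' M) hu)
            (ContMDiffAt.smul_section (hc' N) hv), ?_⟩
        filter_upwards [hsu, htv] with y h1 h2
        simp only [Pi.add_apply, Pi.smul_apply', ← h1, ← h2, smul_add, smul_smul, pow_add,
          mul_comm]
      · obtain ⟨g, hg, hsg⟩ := hs ξ hξ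
        obtain ⟨k, hk, htk⟩ := ht ξ hξ
        refine ⟨g + k, ContMDiffAt.add hg hk, ?_⟩
        filter_upwards [hsg, htk] with y h1 h2
        simp [h1, h2]
    smul_mem' := by
      rintro c s ⟨⟨N, hN⟩, hs⟩
      refine ⟨⟨N, ?_⟩, fun ξ hξ => ?_⟩
      · have h : (fun q => coord p q ^ N • (c • s) q) = c • (fun q => coord p q ^ N • s q) := by
          funext q; exact smul_comm _ _ _
        rw [h]
        exact (holSheaf E p).smul_mem c hN
      · obtain ⟨g, hg, hsg⟩ := hs ξ hξ
        refine ⟨fun y => c * g y, ContMDiffAt.mul contMDiffAt_const hg, ?_⟩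
        filter_upwards [hsg] with y h1
        simp [h1] }

/-- The fibre `𝓖_p / 𝔪_p 𝓖_p` of a vector bundle at `p`. -/
abbrev Fiber (𝓖 : SubSheaf E) (p : X) : Type max u v :=
  (𝓖 p) ⧸ (vanishing 𝓖 p).comap (𝓖 p).subtype

/-- The class of a germ in the fibre, i.e. the value of a section of `𝓖` at `p`. -/
abbrev evalAt (𝓖 : SubSheaf E) (p : X) : (𝓖 p) →ₗ[ℂ] Fiber 𝓖 p :=
  ((vanishing 𝓖 p).comap (𝓖 p).subtype).mkQ

/-- The kernel `l_p ⊆ 𝓖_p / 𝔪_p 𝓖_p` of the bilinear form that `φ` induces on the fibre at `p`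
of a bundle `𝓖` on which it takes values in `𝓛`. -/
def radical (φ : OrthogonalForm E L) (𝓖 : SubSheaf E) (𝓛 : SubSheaf L) (p : X) :
    Submodule ℂ (Fiber 𝓖 p) :=
  Submodule.map (evalAt 𝓖 p)
    { carrier := {s | ∀ t ∈ 𝓖 p, φ.onSec s.1 t ∈ vanishing 𝓛 p}
      zero_mem' := fun t _ => by
        have h : φ.onSec ((0 : 𝓖 p) : Sec E) t = 0 := by
          funext q; simp [OrthogonalForm.onSec]
        rw [h]
        exact Submodule.zero_mem _
      add_mem' := fun {a b} ha hb t ht => by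
        have h : φ.onSec ((a + b : 𝓖 p) : Sec E) t = φ.onSec a.1 t + φ.onSec b.1 t := by
          funext q; simp [OrthogonalForm.onSec]
        rw [h]
        exact Submodule.add_mem _ (ha t ht) (hb t ht)
      smul_mem' := fun c a ha t ht => by
        have h : φ.onSec ((c • a : 𝓖 p) : Sec E) t = c • φ.onSec a.1 t := by
          funext q; simp [OrthogonalForm.onSec]
        rw [h]
        exact Submodule.smul_mem _ c (ha t ht) }

/-- The value at `p` of a section of `𝓖`, modulo the kernel `l_p` of the form on the fibre. -/
abbrev evalModRadical (φ : OrthogonalForm E L) (𝓖 : SubSheaf E) (𝓛 : SubSheaf L) (p : X) :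
    (𝓖 p) →ₗ[ℂ] Fiber 𝓖 p ⧸ radical φ 𝓖 𝓛 p :=
  (radical φ 𝓖 𝓛 p).mkQ ∘ₗ evalAt 𝓖 p

/-- The subspace `S` of `𝓖_p / l_p` (fibre modulo kernel of the form) is isotropic: the form of any
two germs with values in `S`, a section of `𝓛`, vanishes at `p`. -/
def IsIsotropicFiber (φ : OrthogonalForm E L) (𝓖 : SubSheaf E) (𝓛 : SubSheaf L) (p : X)
    (S : Submodule ℂ (Fiber 𝓖 p ⧸ radical φ 𝓖 𝓛 p)) : Prop :=
  ∀ s t : 𝓖 p, evalModRadical φ 𝓖 𝓛 p s ∈ S → evalModRadical φ 𝓖 𝓛 p t ∈ S →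
    φ.onSec s.1 t.1 ∈ vanishing 𝓛 p

open Classical in
/-- The kernel of `𝓖 → (𝓖_x / l_x) / S`, where `𝓖_x` is the fibre at `x` and `l_x` the kernel of
the form on it (`l_x = 0` if the form is nondegenerate at `x`). -/
def heckeDown (φ : OrthogonalForm E L) (𝓖 : SubSheaf E) (𝓛 : SubSheaf L) (x : X)
    (S : Submodule ℂ (Fiber 𝓖 x ⧸ radical φ 𝓖 𝓛 x)) : SubSheaf E := fun p =>
  if p = x then (S.comap (evalModRadical φ 𝓖 𝓛 x)).map (𝓖 x).subtype else 𝓖 p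

end

end Hecke

namespace Hecke

section Functions

variable {X : Type u} [TopologicalSpace X] [ChartedSpace ℂ X]

theorem tendsto_chartAt_punctured (p : X) :
    Tendsto (chartAt ℂ p) (𝓝[≠] p) (𝓝[≠] (chartAt ℂ p p)) := by
  refine tendsto_nhdsWithin_iff.2 ⟨((chartAt ℂ p).continuousAt
    (mem_chart_source ℂ p)).continuousWithinAt, ?_⟩
  filter_upwards [self_mem_nhdsWithin, mem_nhdsWithin_of_mem_nhds
    ((chartAt ℂ p).open_source.mem_nhds (mem_chart_source ℂ p))] with y hy hys h
  exact hy ((chartAt ℂ p).injOn hys (mem_chart_source ℂ p) h)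

theorem tendsto_chartAt_symm_punctured (p : X) :
    Tendsto (chartAt ℂ p).symm (𝓝[≠] (chartAt ℂ p p)) (𝓝[≠] p) := by
  refine tendsto_nhdsWithin_iff.2 ⟨?_, ?_⟩
  · have h := ((chartAt ℂ p).continuousAt_symm (mem_chart_target ℂ p)).continuousWithinAt
      (s := {chartAt ℂ p p}ᶜ)
    rwa [ContinuousWithinAt, (chartAt ℂ p).left_inv (mem_chart_source ℂ p)] at h
  · filter_upwards [self_mem_nhdsWithin, mem_nhdsWithin_of_mem_nhds
      ((chartAt ℂ p).open_target.mem_nhds (mem_chart_target ℂ p))] with y hy hys h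
    apply hy
    rw [Set.mem_singleton_iff] at h ⊢
    exact ((chartAt ℂ p).right_inv hys).symm.trans (congrArg _ h)

theorem eventually_chartAt_left_inv (p : X) :
    ∀ᶠ y in 𝓝 p, (chartAt ℂ p).symm (chartAt ℂ p y) = y := by
  filter_upwards [(chartAt ℂ p).open_source.mem_nhds (mem_chart_source ℂ p)] with y hy
  exact (chartAt ℂ p).left_inv hy

instance neBot_punctured (p : X) : (𝓝[≠] p).NeBot :=
  (tendsto_chartAt_symm_punctured p).neBot

theorem eventually_punctured_chartAt_iff {p : X} {P : X → Prop} :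
    (∀ᶠ w in 𝓝[≠] (chartAt ℂ p p), P ((chartAt ℂ p).symm w)) ↔ ∀ᶠ y in 𝓝[≠] p, P y := by
  refine ⟨fun h => ?_, fun h => (tendsto_chartAt_symm_punctured p).eventually h⟩
  filter_upwards [(tendsto_chartAt_punctured p).eventually h,
    (eventually_chartAt_left_inv p).filter_mono nhdsWithin_le_nhds] with y h1 h2
  rwa [h2] at h1

theorem holFun_iff {f : X → ℂ} {p : X} :
    HolFun f p ↔ AnalyticAt ℂ (f ∘ (chartAt ℂ p).symm) (chartAt ℂ p p) := by
  rw [HolFun, contMDiffAt_iff_source]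
  simp only [mfld_simps]
  rw [contMDiffWithinAt_univ, contMDiffAt_iff_contDiffAt, ← contDiffWithinAt_univ,
    contDiffWithinAt_omega_iff_analyticWithinAt, analyticWithinAt_univ]

theorem HolFun.of_analyticAt {g : ℂ → ℂ} {p : X} (hg : AnalyticAt ℂ g (chartAt ℂ p p)) :
    HolFun (fun y => g (chartAt ℂ p y)) p := by
  rw [holFun_iff]
  refine hg.congr ?_
  filter_upwards [(chartAt ℂ p).open_target.mem_nhds (mem_chart_target ℂ p)] with w hw
  simp [(chartAt ℂ p).right_inv hw]

theorem HolFun.const (c : ℂ) (p : X) : HolFun (fun _ => c) p := contMDiffAt_const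

theorem HolFun.add {f g : X → ℂ} {p : X} (hf : HolFun f p) (hg : HolFun g p) :
    HolFun (fun y => f y + g y) p := ContMDiffAt.add hf hg

theorem HolFun.mul {f g : X → ℂ} {p : X} (hf : HolFun f p) (hg : HolFun g p) :
    HolFun (fun y => f y * g y) p := ContMDiffAt.mul hf hg

theorem HolFun.sum {ι : Type*} {s : Finset ι} {f : ι → X → ℂ} {p : X}
    (hf : ∀ i ∈ s, HolFun (f i) p) : HolFun (fun y => ∑ i ∈ s, f i y) p := by
  classical
  induction s using Finset.induction_on with
  | empty => simpa using HolFun.const 0 p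
  | insert a s ha ih =>
    simp only [Finset.sum_insert ha]
    exact (hf a (by simp)).add (ih fun i hi => hf i (by simp [hi]))

theorem HolFun.prod {ι : Type*} {s : Finset ι} {f : ι → X → ℂ} {p : X}
    (hf : ∀ i ∈ s, HolFun (f i) p) : HolFun (fun y => ∏ i ∈ s, f i y) p := by
  classical
  induction s using Finset.induction_on with
  | empty => simpa using HolFun.const 1 p
  | insert a s ha ih =>
    simp only [Finset.prod_insert ha]
    exact (hf a (by simp)).mul (ih fun i hi => hf i (by simp [hi]))

theorem HolFun.inv {f : X → ℂ} {p : X} (hf : HolFun f p) (h0 : f p ≠ 0) :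
    HolFun (fun y => (f y)⁻¹) p := by
  rw [holFun_iff] at hf ⊢
  refine AnalyticAt.inv hf ?_
  simpa using h0

theorem HolFun.zpow {f : X → ℂ} {p : X} (hf : HolFun f p) (h0 : f p ≠ 0) (k : ℤ) :
    HolFun (fun y => f y ^ k) p := by
  rw [holFun_iff] at hf ⊢
  refine AnalyticAt.zpow hf ?_
  simpa using h0

theorem HolFun.pow {f : X → ℂ} {p : X} (hf : HolFun f p) (k : ℕ) :
    HolFun (fun y => f y ^ k) p := ContMDiffAt.pow hf k

theorem HolFun.det {ι : Type*} [Fintype ι] [DecidableEq ι] {a : ι → ι → X → ℂ} {p : X}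
    (h : ∀ i j, HolFun (a i j) p) : HolFun (fun y => (Matrix.of fun i j => a i j y).det) p := by
  simp only [Matrix.det_apply']
  exact HolFun.sum fun σ _ => (HolFun.const _ p).mul (HolFun.prod fun i _ => h _ _)

theorem HolFun.eventually [IsManifold 𝓘(ℂ) ω X] {f : X → ℂ} {p : X} (hf : HolFun f p) :
    ∀ᶠ q in 𝓝 p, HolFun f q :=
  (contMDiffAt_iff_contMDiffAt_nhds (by simp)).1 hf

theorem HolFun.continuousAt {f : X → ℂ} {p : X} (hf : HolFun f p) : ContinuousAt f p :=
  ContMDiffAt.continuousAt hf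

theorem HolFun.tendsto {f : X → ℂ} {p : X} (hf : HolFun f p) :
    Tendsto f (𝓝[≠] p) (𝓝 (f p)) := hf.continuousAt.continuousWithinAt

theorem HolFun.eq_of_eventuallyEq {f g : X → ℂ} {p : X} (hf : HolFun f p) (hg : HolFun g p)
    (h : ∀ᶠ y in 𝓝[≠] p, f y = g y) : f p = g p :=
  tendsto_nhds_unique hf.tendsto (hg.tendsto.congr' (h.mono fun _ h => h.symm))

/-! ### The local coordinate -/

@[simp] theorem coord_self (p : X) : coord p p = 0 := by simp [coord]

theorem eventually_holFun_coord [IsManifold 𝓘(ℂ) ω X] (p : X) :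
    ∀ᶠ q in 𝓝 p, HolFun (coord p) q := (holFun_coord p).eventually

theorem eventually_coord_ne_zero (p : X) : ∀ᶠ y in 𝓝[≠] p, coord p y ≠ 0 := by
  filter_upwards [(tendsto_chartAt_punctured p).eventually self_mem_nhdsWithin] with y hy h
  exact hy (by simpa [coord, sub_eq_zero] using h)

theorem HolFun.exists_eq_coord_mul {f : X → ℂ} {p : X} (hf : HolFun f p) (h0 : f p = 0) :
    ∃ g : X → ℂ, HolFun g p ∧ ∀ᶠ y in 𝓝 p, f y = coord p y * g y := by
  rw [holFun_iff] at hf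
  have h := (AnalyticAt.hasFPowerSeriesAt hf)
  have hd : AnalyticAt ℂ (dslope (f ∘ (chartAt ℂ p).symm) (chartAt ℂ p p)) (chartAt ℂ p p) :=
    ⟨_, h.has_fpower_series_dslope_fslope⟩
  refine ⟨_, HolFun.of_analyticAt hd, ?_⟩
  filter_upwards [eventually_chartAt_left_inv p] with y hy
  have := sub_smul_dslope (f ∘ (chartAt ℂ p).symm) (chartAt ℂ p p) (chartAt ℂ p y)
  simp only [smul_eq_mul, Function.comp_apply, hy] at this
  rw [(chartAt ℂ p).left_inv (mem_chart_source ℂ p), h0, sub_zero] at this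
  exact this.symm

/-! ### Meromorphic functions -/

theorem HolFun.meroFun {f : X → ℂ} {p : X} (hf : HolFun f p) : MeroFun f p :=
  (holFun_iff.1 hf).meromorphicAt

theorem MeroFun.mul {f g : X → ℂ} {p : X} (hf : MeroFun f p) (hg : MeroFun g p) :
    MeroFun (fun y => f y * g y) p := MeromorphicAt.mul hf hg

theorem MeroFun.add {f g : X → ℂ} {p : X} (hf : MeroFun f p) (hg : MeroFun g p) :
    MeroFun (fun y => f y + g y) p := MeromorphicAt.add hf hg

theorem MeroFun.inv {f : X → ℂ} {p : X} (hf : MeroFun f p) :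
    MeroFun (fun y => (f y)⁻¹) p := MeromorphicAt.inv hf

theorem MeroFun.zpow {f : X → ℂ} {p : X} (hf : MeroFun f p) (k : ℤ) :
    MeroFun (fun y => f y ^ k) p := MeromorphicAt.zpow hf k

theorem MeroFun.sum {ι : Type*} {s : Finset ι} {f : ι → X → ℂ} {p : X}
    (hf : ∀ i ∈ s, MeroFun (f i) p) : MeroFun (fun y => ∑ i ∈ s, f i y) p :=
  by
  classical
  induction s using Finset.induction_on with
  | empty => simpa using (HolFun.const 0 p).meroFun
  | insert a s ha ih =>
    simp only [Finset.sum_insert ha]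
    exact (hf a (by simp)).add (ih fun i hi => hf i (by simp [hi]))

theorem MeroFun.prod {ι : Type*} {s : Finset ι} {f : ι → X → ℂ} {p : X}
    (hf : ∀ i ∈ s, MeroFun (f i) p) : MeroFun (fun y => ∏ i ∈ s, f i y) p :=
  by
  classical
  induction s using Finset.induction_on with
  | empty => simpa using (HolFun.const 1 p).meroFun
  | insert a s ha ih =>
    simp only [Finset.prod_insert ha]
    exact (hf a (by simp)).mul (ih fun i hi => hf i (by simp [hi]))

theorem MeroFun.det {ι : Type*} [Fintype ι] [DecidableEq ι] {a : ι → ι → X → ℂ} {p : X}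
    (h : ∀ i j, MeroFun (a i j) p) : MeroFun (fun y => (Matrix.of fun i j => a i j y).det) p := by
  simp only [Matrix.det_apply']
  exact MeroFun.sum fun σ _ => (HolFun.const _ p).meroFun.mul (MeroFun.prod fun i _ => h _ _)

theorem ordFun_congr {f g : X → ℂ} {p : X} (h : ∀ᶠ y in 𝓝[≠] p, f y = g y) :
    ordFun f p = ordFun g p :=
  meromorphicOrderAt_congr ((tendsto_chartAt_symm_punctured p).eventually h)

theorem ordFun_mul {f g : X → ℂ} {p : X} (hf : MeroFun f p) (hg : MeroFun g p) :
    ordFun (fun y => f y * g y) p = ordFun f p + ordFun g p :=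
  meromorphicOrderAt_mul hf hg

theorem HolFun.ordFun_eq_zero {f : X → ℂ} {p : X} (hf : HolFun f p) (h0 : f p ≠ 0) :
    ordFun f p = 0 := by
  refine (tendsto_ne_zero_iff_meromorphicOrderAt_eq_zero hf.meroFun).1 ⟨f p, h0, ?_⟩
  exact hf.tendsto.comp (tendsto_chartAt_symm_punctured p)

theorem HolFun.ne_zero_of_ordFun {f : X → ℂ} {p : X} (hf : HolFun f p) (h0 : ordFun f p = 0) :
    f p ≠ 0 := by
  obtain ⟨c, hc, h⟩ := (tendsto_ne_zero_iff_meromorphicOrderAt_eq_zero hf.meroFun).2 h0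
  rwa [tendsto_nhds_unique (hf.tendsto.comp (tendsto_chartAt_symm_punctured p)) h]

theorem ordFun_coord_zpow (p : X) (k : ℤ) : ordFun (fun y => coord p y ^ k) p = k := by
  refine (meromorphicOrderAt_congr (f₂ := fun w => (w - chartAt ℂ p p) ^ k) ?_).trans
    fun_meromorphicOrderAt_zpow_id_sub_const
  filter_upwards [mem_nhdsWithin_of_mem_nhds
      ((chartAt ℂ p).open_target.mem_nhds (mem_chart_target ℂ p))] with w hw
  simp [coord, (chartAt ℂ p).right_inv hw]

theorem meroFun_coord_zpow [IsManifold 𝓘(ℂ) ω X] (p : X) (k : ℤ) :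
    MeroFun (fun y => coord p y ^ k) p := (holFun_coord p).meroFun.zpow k

theorem eventually_ne_zero_of_ordFun {f : X → ℂ} {p : X} (hf : MeroFun f p) {k : ℤ}
    (h : ordFun f p = k) : ∀ᶠ y in 𝓝[≠] p, f y ≠ 0 :=
  eventually_punctured_chartAt_iff.1
    ((meromorphicOrderAt_ne_top_iff_eventually_ne_zero hf).1 (by
      change ordFun f p ≠ ⊤
      rw [h]; exact WithTop.coe_ne_top))

end Functions


section Sections

variable {X : Type u} [TopologicalSpace X] [ChartedSpace ℂ X] {r : ℕ}
  {E : HolVectorBundle.{u, v} X r}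

/-! ### Holomorphic sections -/

theorem HolSec.zero (p : X) : HolSec E 0 p := by
  have h : ContMDiff 𝓘(ℂ) (𝓘(ℂ).prod 𝓘(ℂ, Fin r → ℂ)) ω (zeroSection (Fin r → ℂ) E.fiber) :=
    contMDiff_zeroSection ℂ E.fiber
  exact h p

theorem HolSec.add {s t : Sec E} {p : X} (hs : HolSec E s p) (ht : HolSec E t p) :
    HolSec E (s + t) p := ContMDiffAt.add_section hs ht

theorem HolSec.smul {f : X → ℂ} {s : Sec E} {p : X} (hf : HolFun f p) (hs : HolSec E s p) :
    HolSec E (fun y => f y • s y) p := ContMDiffAt.smul_section hf hs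

theorem HolSec.sum {ι : Type*} {t : Finset ι} {s : ι → Sec E} {p : X}
    (hs : ∀ i ∈ t, HolSec E (s i) p) : HolSec E (fun y => ∑ i ∈ t, s i y) p := by
  classical
  induction t using Finset.induction_on with
  | empty => exact HolSec.zero p
  | insert a t ha ih =>
    simp only [Finset.sum_insert ha]
    exact (hs a (by simp)).add (ih fun i hi => hs i (by simp [hi]))

variable (E) in
theorem exists_dual_frames (p : X) :
    ∃ (N : Set X) (b : Fin r → Sec E) (c : Fin r → ∀ q, Module.Dual ℂ (E.fiber q)),
      IsOpen N ∧ p ∈ N ∧ ∀ q ∈ N, (∀ i, HolSec E (b i) q) ∧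
        (∀ a : E.fiber q, a = ∑ i, c i q a • b i q) ∧
        (∀ i j, c i q (b j q) = if i = j then 1 else 0) ∧ ∀ i, HolDualSec E (c i) q := by
  have : ContMDiffVectorBundle 1 (Fin r → ℂ) E.fiber 𝓘(ℂ) :=
    ContMDiffVectorBundle.of_le (n := ω) le_top
  let e := trivializationAt (Fin r → ℂ) E.fiber p
  let β := Pi.basisFun ℂ (Fin r)
  refine ⟨e.baseSet, e.localFrame β, e.localFrameCoeff 𝓘(ℂ) β, e.open_baseSet,
    mem_baseSet_trivializationAt _ _ p, fun q hq => ⟨fun i => ?_, fun a => ?_, fun i j => ?_,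
      fun i s hs => ?_⟩⟩
  · exact contMDiffAt_localFrame_of_mem ω e β i hq
  · classical
    let s : Sec E := Function.update 0 q a
    have := Trivialization.eq_sum_localFrameCoeff_smul (I := 𝓘(ℂ)) (b := β) (s := s) hq
    simpa [s] using this
  · rw [e.localFrameCoeff_apply_of_mem_baseSet β hq (e.localFrame β j)]
    simp [hq, Finsupp.single_apply, eq_comm]
  · exact contMDiffAt_localFrameCoeff β hq hs i

theorem finrank_fiber (p : X) : Module.finrank ℂ (E.fiber p) = r := by
  have := (Trivialization.linearEquivAt (R := ℂ) (trivializationAt (Fin r → ℂ) E.fiber p) p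
    (mem_baseSet_trivializationAt _ _ p)).finrank_eq
  simpa using this

instance finiteDimensional_fiber (p : X) : FiniteDimensional ℂ (E.fiber p) :=
  Module.Finite.equiv (Trivialization.linearEquivAt (R := ℂ)
    (trivializationAt (Fin r → ℂ) E.fiber p) p (mem_baseSet_trivializationAt _ _ p)).symm

theorem exists_holSec_eq (p : X) (a : E.fiber p) : ∃ u : Sec E, HolSec E u p ∧ u p = a := by
  obtain ⟨N, b, c, hN, hp, h⟩ := exists_dual_frames E p
  refine ⟨fun y => ∑ i, c i p a • b i y, HolSec.sum fun i _ =>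
    HolSec.smul (HolFun.const _ p) ((h p hp).1 i), ((h p hp).2.1 a).symm⟩

theorem HolSec.eq_of_eventuallyEq {s t : Sec E} {p : X} (hs : HolSec E s p) (ht : HolSec E t p)
    (h : ∀ᶠ y in 𝓝[≠] p, s y = t y) : s p = t p := by
  obtain ⟨N, b, c, hN, hp, hb⟩ := exists_dual_frames E p
  rw [(hb p hp).2.1 (s p), (hb p hp).2.1 (t p)]
  refine Finset.sum_congr rfl fun i _ => ?_
  rw [((hb p hp).2.2.2 i s hs).eq_of_eventuallyEq ((hb p hp).2.2.2 i t ht)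
    (h.mono fun y hy => by rw [hy])]

theorem HolSec.exists_eq_coord_smul {s : Sec E} {p : X} (hs : HolSec E s p) (h0 : s p = 0) :
    ∃ u : Sec E, HolSec E u p ∧ ∀ᶠ y in 𝓝 p, s y = coord p y • u y := by
  obtain ⟨N, b, c, hN, hp, hb⟩ := exists_dual_frames E p
  have h1 : ∀ i, ∃ g : X → ℂ, HolFun g p ∧ ∀ᶠ y in 𝓝 p, c i y (s y) = coord p y * g y :=
    fun i => HolFun.exists_eq_coord_mul ((hb p hp).2.2.2 i s hs) (by rw [h0, map_zero])
  choose g hg hg' using h1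
  refine ⟨fun y => ∑ i, g i y • b i y, HolSec.sum fun i _ => HolSec.smul (hg i) ((hb p hp).1 i),
    ?_⟩
  filter_upwards [hN.mem_nhds hp, eventually_all.2 hg'] with y hy h2
  rw [(hb y hy).2.1 (s y), Finset.smul_sum]
  exact Finset.sum_congr rfl fun i _ => by rw [h2, mul_smul]

variable (E) in
theorem exists_holDualSec_eq (p : X) (ξ : Module.Dual ℂ (E.fiber p)) :
    ∃ η : ∀ q, Module.Dual ℂ (E.fiber q), HolDualSec E η p ∧ η p = ξ := by
  obtain ⟨N, b, c, hN, hp, h⟩ := exists_dual_frames E p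
  refine ⟨fun y => ∑ i, ξ (b i p) • c i y, fun s hs => ?_, ?_⟩
  · simp only [LinearMap.sum_apply, LinearMap.smul_apply, smul_eq_mul]
    exact HolFun.sum fun i _ => (HolFun.const _ p).mul ((h p hp).2.2.2 i s hs)
  · ext a
    conv_rhs => rw [(h p hp).2.1 a, map_sum]
    simp [mul_comm]

/-! ### Germs -/

theorem mem_holSheaf {s : Sec E} {p : X} :
    s ∈ holSheaf E p ↔ ∃ u : Sec E, HolSec E u p ∧ ∀ᶠ y in 𝓝[≠] p, s y = u y := Iff.rfl

theorem mem_vanishing {𝓖 : SubSheaf E} {s : Sec E} {p : X} :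
    s ∈ vanishing 𝓖 p ↔ ∃ u ∈ 𝓖 p, ∀ᶠ y in 𝓝[≠] p, s y = coord p y • u y := Iff.rfl

theorem HolSec.mem {s : Sec E} {p : X} (hs : HolSec E s p) : s ∈ holSheaf E p :=
  ⟨s, hs, Eventually.of_forall fun _ => rfl⟩

theorem holSheaf_congr {s t : Sec E} {p : X} (hs : s ∈ holSheaf E p)
    (h : ∀ᶠ y in 𝓝[≠] p, t y = s y) : t ∈ holSheaf E p := by
  obtain ⟨u, hu, hsu⟩ := hs
  exact ⟨u, hu, by filter_upwards [h, hsu] with y h1 h2; rw [h1, h2]⟩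

theorem holSheaf_smul {f : X → ℂ} {s : Sec E} {p : X} (hf : HolFun f p) (hs : s ∈ holSheaf E p) :
    (fun y => f y • s y) ∈ holSheaf E p := by
  obtain ⟨u, hu, hsu⟩ := hs
  exact ⟨_, hu.smul hf, by filter_upwards [hsu] with y h1; rw [h1]⟩

theorem mem_twist_self {𝓖 : SubSheaf E} {s : Sec E} {x : X} :
    s ∈ twist 𝓖 x x ↔ (fun q => coord x q • s q) ∈ 𝓖 x := by
  rw [twist, if_pos rfl]; rfl

theorem twist_of_ne {𝓖 : SubSheaf E} {x p : X} (h : p ≠ x) : twist 𝓖 x p = 𝓖 p := by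
  rw [twist, if_neg h]

theorem meroSec_of_mem {s : Sec E} {p : X} (hs : s ∈ holSheaf E p) : MeroSec E s p :=
  ⟨0, by simpa using hs⟩

theorem MeroSec.smul {f : X → ℂ} {s : Sec E} {p : X} (hf : HolFun f p) (hs : MeroSec E s p) :
    MeroSec E (fun y => f y • s y) p := by
  obtain ⟨N, hN⟩ := hs
  refine ⟨N, holSheaf_congr (holSheaf_smul hf hN) (Eventually.of_forall fun y => ?_)⟩
  exact smul_comm _ _ _

variable [IsManifold 𝓘(ℂ) ω X]

theorem MeroSec.pow_mem {s : Sec E} {p : X} {N M : ℕ}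
    (h : (fun q => coord p q ^ N • s q) ∈ holSheaf E p) (hNM : N ≤ M) :
    (fun q => coord p q ^ M • s q) ∈ holSheaf E p := by
  obtain ⟨k, rfl⟩ := Nat.exists_eq_add_of_le hNM
  refine holSheaf_congr (holSheaf_smul ((holFun_coord p).pow k) h)
    (Eventually.of_forall fun y => ?_)
  simp only [smul_smul, pow_add, mul_comm]

theorem MeroSec.add {s t : Sec E} {p : X} (hs : MeroSec E s p) (ht : MeroSec E t p) :
    MeroSec E (s + t) p := by
  obtain ⟨N, hN⟩ := hs
  obtain ⟨M, hM⟩ := ht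
  refine ⟨max N M, holSheaf_congr ((holSheaf E p).add_mem (MeroSec.pow_mem hN (le_max_left N M))
    (MeroSec.pow_mem hM (le_max_right N M))) (Eventually.of_forall fun y => ?_)⟩
  simp

theorem MeroSec.coord_zpow_smul {s : Sec E} {p : X} (hs : MeroSec E s p) (k : ℤ) :
    MeroSec E (fun y => coord p y ^ k • s y) p := by
  obtain ⟨N, hN⟩ := hs
  refine ⟨N + k.natAbs, holSheaf_congr
    (holSheaf_smul ((holFun_coord p).pow (k + k.natAbs).toNat) hN) ?_⟩
  filter_upwards [eventually_coord_ne_zero p] with y hy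
  have h1 : (((k + k.natAbs).toNat : ℕ) : ℤ) = k + k.natAbs := Int.toNat_of_nonneg (by omega)
  simp only [smul_smul, ← zpow_natCast, h1]
  congr 1
  push_cast
  rw [← zpow_add₀ hy, ← zpow_add₀ hy]
  congr 1
  ring

theorem MeroSec.sum {ι : Type*} {t : Finset ι} {s : ι → Sec E} {p : X}
    (hs : ∀ i ∈ t, MeroSec E (s i) p) : MeroSec E (fun y => ∑ i ∈ t, s i y) p := by
  classical
  induction t using Finset.induction_on with
  | empty => exact meroSec_of_mem (HolSec.zero p).mem
  | insert a t ha ih =>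
    simp only [Finset.sum_insert ha]
    exact (hs a (by simp)).add (ih fun i hi => hs i (by simp [hi]))

end Sections


section Frames

variable {X : Type u} [TopologicalSpace X] [ChartedSpace ℂ X] {r : ℕ}
  {E : HolVectorBundle.{u, v} X r} {ι κ : Type*} [Fintype ι] [Fintype κ]

/-- The meromorphic sections `e i` are a basis of the stalk `𝓖_q` over the local ring `𝒪_q`. -/
def StalkFrame (𝓖 : SubSheaf E) (q : X) (e : ι → Sec E) : Prop :=
  (∀ i, MeroSec E (e i) q) ∧
  (∀ᶠ y in 𝓝[≠] q, LinearIndependent ℂ fun i => e i y) ∧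
  ∀ s : Sec E, s ∈ 𝓖 q ↔
    ∃ f : ι → X → ℂ, (∀ i, HolFun (f i) q) ∧ ∀ᶠ y in 𝓝[≠] q, s y = ∑ i, f i y • e i y

theorem isFrame_iff {𝓖 : SubSheaf E} {p : X} {e : ι → Sec E} :
    IsFrame 𝓖 p e ↔ ∀ᶠ q in 𝓝 p, StalkFrame 𝓖 q e := Iff.rfl

theorem IsFrame.stalkFrame {𝓖 : SubSheaf E} {p : X} {e : ι → Sec E} (h : IsFrame 𝓖 p e) :
    StalkFrame 𝓖 p e := (isFrame_iff.1 h).self_of_nhds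

theorem IsFrame.congr_of_ne [T1Space X] {𝓖 𝓖' : SubSheaf E} {x p : X} {e : ι → Sec E}
    (h : IsFrame 𝓖 p e) (hne : p ≠ x) (h' : ∀ q, q ≠ x → 𝓖' q = 𝓖 q) : IsFrame 𝓖' p e := by
  filter_upwards [h, isOpen_compl_singleton.mem_nhds hne] with q hq hqx
  rwa [h' q hqx]

namespace StalkFrame

variable {𝓖 : SubSheaf E} {q : X} {e : ι → Sec E}

theorem sum_mem (h : StalkFrame 𝓖 q e) {f : ι → X → ℂ} (hf : ∀ i, HolFun (f i) q) :
    (fun y => ∑ i, f i y • e i y) ∈ 𝓖 q :=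
  (h.2.2 _).2 ⟨f, hf, Eventually.of_forall fun _ => rfl⟩

theorem congr_mem (h : StalkFrame 𝓖 q e) {s t : Sec E} (hs : s ∈ 𝓖 q)
    (hst : ∀ᶠ y in 𝓝[≠] q, t y = s y) : t ∈ 𝓖 q := by
  obtain ⟨f, hf, hsf⟩ := (h.2.2 s).1 hs
  exact (h.2.2 t).2 ⟨f, hf, by filter_upwards [hsf, hst] with y h1 h2; rw [h2, h1]⟩

theorem linearCombination_mem (h : StalkFrame 𝓖 q e) (v : ι → ℂ) :
    Fintype.linearCombination ℂ e v ∈ 𝓖 q :=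
  h.congr_mem (h.sum_mem fun i => HolFun.const (v i) q)
    (Eventually.of_forall fun y => by simp [Fintype.linearCombination_apply])

theorem mem (h : StalkFrame 𝓖 q e) (i : ι) : e i ∈ 𝓖 q := by
  classical
  simpa using h.linearCombination_mem (Pi.single i 1)

theorem coeff_unique (h : StalkFrame 𝓖 q e) {f g : ι → X → ℂ}
    (hfg : ∀ᶠ y in 𝓝[≠] q, ∑ i, f i y • e i y = ∑ i, g i y • e i y) :
    ∀ᶠ y in 𝓝[≠] q, ∀ i, f i y = g i y := by
  filter_upwards [h.2.1, hfg] with y h1 h2 i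
  have := Fintype.linearIndependent_iff.1 h1 (fun i => f i y - g i y)
    (by simp [sub_smul, Finset.sum_sub_distrib, h2]) i
  exact sub_eq_zero.1 this

theorem mem_vanishing_iff (h : StalkFrame 𝓖 q e) {f : ι → X → ℂ} (hf : ∀ i, HolFun (f i) q)
    {s : Sec E} (hs : ∀ᶠ y in 𝓝[≠] q, s y = ∑ i, f i y • e i y)
    [IsManifold 𝓘(ℂ) ω X] : s ∈ vanishing 𝓖 q ↔ ∀ i, f i q = 0 := by
  constructor
  · rintro ⟨u, hu, hsu⟩ i
    obtain ⟨g, hg, hug⟩ := (h.2.2 u).1 hu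
    have h1 : ∀ᶠ y in 𝓝[≠] q, ∀ i, f i y = coord q y * g i y := by
      apply h.coeff_unique
      filter_upwards [hs, hsu, hug] with y h1 h2 h3
      rw [← h1, h2, h3, Finset.smul_sum]
      simp only [mul_smul]
    have := (hf i).eq_of_eventuallyEq ((holFun_coord q).mul (hg i)) (h1.mono fun y hy => hy i)
    simpa using this
  · intro h0
    choose g hg hfg using fun i => (hf i).exists_eq_coord_mul (h0 i)
    refine ⟨_, h.sum_mem hg, ?_⟩
    filter_upwards [hs, (eventually_all.2 hfg).filter_mono nhdsWithin_le_nhds] with y h1 h2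
    rw [h1, Finset.smul_sum]
    exact Finset.sum_congr rfl fun i _ => by rw [h2, mul_smul]

theorem sub_linearCombination_mem_vanishing [IsManifold 𝓘(ℂ) ω X] (h : StalkFrame 𝓖 q e)
    {f : ι → X → ℂ} (hf : ∀ i, HolFun (f i) q)
    {s : Sec E} (hs : ∀ᶠ y in 𝓝[≠] q, s y = ∑ i, f i y • e i y) :
    s - Fintype.linearCombination ℂ e (fun i => f i q) ∈ vanishing 𝓖 q := by
  refine (h.mem_vanishing_iff (f := fun i y => f i y + -f i q)
    (fun i => (hf i).add (HolFun.const _ q)) ?_).2 fun i => by ring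
  filter_upwards [hs] with y h1
  simp [h1, Fintype.linearCombination_apply, add_smul, Finset.sum_add_distrib, sub_eq_add_neg]

theorem mem_iff_of_vanishing_le [IsManifold 𝓘(ℂ) ω X] (h : StalkFrame 𝓖 q e)
    {P : Submodule ℂ (Sec E)} (hP : vanishing 𝓖 q ≤ P)
    {f : ι → X → ℂ} (hf : ∀ i, HolFun (f i) q)
    {s : Sec E} (hs : ∀ᶠ y in 𝓝[≠] q, s y = ∑ i, f i y • e i y) :
    s ∈ P ↔ Fintype.linearCombination ℂ e (fun i => f i q) ∈ P := by
  have := hP (h.sub_linearCombination_mem_vanishing hf hs)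
  exact ⟨fun hs => by simpa using P.sub_mem hs this, fun ht => by simpa using P.add_mem this ht⟩

theorem unit_smul (h : StalkFrame 𝓖 q e) {g : ι → X → ℂ} (hg : ∀ i, HolFun (g i) q)
    (h0 : ∀ i, g i q ≠ 0) : StalkFrame 𝓖 q fun i y => g i y • e i y := by
  have h0' : ∀ᶠ y in 𝓝[≠] q, ∀ i, g i y ≠ 0 := (eventually_all.2 fun i =>
    (hg i).continuousAt.eventually_ne (h0 i)).filter_mono nhdsWithin_le_nhds
  refine ⟨fun i => (h.1 i).smul (hg i), ?_, fun s => ?_⟩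
  · filter_upwards [h.2.1, h0'] with y h1 h2
    rw [Fintype.linearIndependent_iff] at h1 ⊢
    intro a ha i
    have := h1 (fun i => a i * g i y) (by simpa only [mul_smul] using ha) i
    exact (mul_eq_zero.1 this).resolve_right (h2 i)
  · rw [h.2.2 s]
    constructor
    · rintro ⟨f, hf, hs⟩
      refine ⟨fun i y => f i y * (g i y)⁻¹, fun i => (hf i).mul ((hg i).inv (h0 i)), ?_⟩
      filter_upwards [hs, h0'] with y h1 h2
      rw [h1]
      exact Finset.sum_congr rfl fun i _ => by rw [smul_smul, inv_mul_cancel_right₀ (h2 i)]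
    · rintro ⟨f, hf, hs⟩
      exact ⟨fun i y => f i y * g i y, fun i => (hf i).mul (hg i),
        hs.mono fun y hy => by rw [hy]; simp only [mul_smul]⟩

theorem sum_repr_smul {M : Type*} [AddCommGroup M] [Module ℂ M] (c : Module.Basis κ ℂ (ι → ℂ))
    (v : ι → ℂ) (m : ι → M) : ∑ k, c.repr v k • ∑ i, c k i • m i = ∑ i, v i • m i := by
  have := congrArg (Fintype.linearCombination ℂ m) (c.sum_repr v)
  rw [map_sum] at this
  simpa only [map_smul, Fintype.linearCombination_apply] using this

theorem holFun_repr {κ : Type*} (c : Module.Basis κ ℂ (ι → ℂ)) {f : ι → X → ℂ} (hf : ∀ i, HolFun (f i) q)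
    (k : κ) : HolFun (fun y => c.repr (fun i => f i y) k) q := by
  classical
  have h : ∀ y, c.repr (fun i => f i y) k = ∑ i, f i y * c.repr (Pi.single i 1) k := by
    intro y
    conv_lhs => rw [pi_eq_sum_univ' (fun i => f i y)]
    simp [Finsupp.finsetSum_apply]
  simp only [h]
  exact HolFun.sum fun i _ => (hf i).mul (HolFun.const _ q)

theorem basis_change [IsManifold 𝓘(ℂ) ω X] (h : StalkFrame 𝓖 q e)
    (c : Module.Basis κ ℂ (ι → ℂ)) :
    StalkFrame 𝓖 q fun k y => ∑ i, c k i • e i y := by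
  refine ⟨fun k => MeroSec.sum fun i _ => (h.1 i).smul (HolFun.const _ q), ?_, fun s => ?_⟩
  · filter_upwards [h.2.1] with y hy
    have := c.linearIndependent.map' (Fintype.linearCombination ℂ fun i => e i y)
      (LinearMap.ker_eq_bot.2 hy.fintypeLinearCombination_injective)
    simpa [Function.comp_def, Fintype.linearCombination_apply] using this
  · rw [h.2.2 s]
    constructor
    · rintro ⟨f, hf, hs⟩
      exact ⟨fun k y => c.repr (fun i => f i y) k, holFun_repr c hf,
        hs.mono fun y hy => by rw [hy, sum_repr_smul]⟩
    · rintro ⟨g, hg, hs⟩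
      refine ⟨fun i y => ∑ k, g k y * c k i,
        fun i => HolFun.sum fun k _ => (hg k).mul (HolFun.const _ q), hs.mono fun y hy => ?_⟩
      simp only [hy, Finset.smul_sum, Finset.sum_smul, mul_smul]
      exact Finset.sum_comm

end StalkFrame

theorem IsFrame.basis_change [IsManifold 𝓘(ℂ) ω X] {𝓖 : SubSheaf E} {p : X} {e : ι → Sec E}
    (h : IsFrame 𝓖 p e) (c : Module.Basis κ ℂ (ι → ℂ)) :
    IsFrame 𝓖 p fun k y => ∑ i, c k i • e i y :=
  (isFrame_iff.1 h).mono fun _ hq => StalkFrame.basis_change hq c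

theorem IsFrame.coord_zpow_smul [IsManifold 𝓘(ℂ) ω X] {𝓖 𝓖' : SubSheaf E} {x : X}
    {e : ι → Sec E} (h : IsFrame 𝓖 x e) (ε : ι → ℤ) (h' : ∀ q, q ≠ x → 𝓖' q = 𝓖 q)
    (hx : ∀ s : Sec E, s ∈ 𝓖' x ↔ ∃ f : ι → X → ℂ, (∀ i, HolFun (f i) x) ∧
      ∀ᶠ y in 𝓝[≠] x, s y = ∑ i, (f i y * coord x y ^ ε i) • e i y) :
    IsFrame 𝓖' x fun i y => coord x y ^ ε i • e i y := by
  rw [isFrame_iff]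
  have h1 : ∀ᶠ q in 𝓝 x, q ≠ x → coord x q ≠ 0 :=
    eventually_nhdsWithin_iff.1 (eventually_coord_ne_zero x)
  filter_upwards [isFrame_iff.1 h, eventually_holFun_coord x, h1] with q hq hz hz0
  rcases eq_or_ne q x with rfl | hqx
  · refine ⟨fun i => (hq.1 i).coord_zpow_smul _, ?_, fun s => by simp only [hx s, mul_smul]⟩
    filter_upwards [hq.2.1, eventually_coord_ne_zero q] with y h1 h2
    rw [Fintype.linearIndependent_iff] at h1 ⊢
    intro a ha i
    have := h1 (fun i => a i * coord q y ^ ε i) (by simpa only [mul_smul] using ha) i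
    exact (mul_eq_zero.1 this).resolve_right (zpow_ne_zero _ h2)
  · have := hq.unit_smul (g := fun i y => coord x y ^ ε i) (fun i => hz.zpow (hz0 hqx) _)
      fun i => zpow_ne_zero _ (hz0 hqx)
    rwa [StalkFrame, h' q hqx]

theorem exists_isFrame_holSheaf [IsManifold 𝓘(ℂ) ω X] (E : HolVectorBundle.{u, v} X r) (p : X) :
    ∃ b : Fin r → Sec E, IsFrame (holSheaf E) p b ∧ (∀ i, HolSec E (b i) p) ∧
      ∃ β : Module.Basis (Fin r) ℂ (E.fiber p), ∀ i, β i = b i p := by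
  obtain ⟨N, b, c, hN, hp, hb⟩ := exists_dual_frames E p
  have hli : ∀ y ∈ N, LinearIndependent ℂ fun i => b i y := by
    intro y hy
    rw [Fintype.linearIndependent_iff]
    intro a ha i
    have := congrArg (c i y) ha
    simpa [(hb y hy).2.2.1] using this
  refine ⟨b, ?_, (hb p hp).1, Module.Basis.mk (hli p hp) fun a _ => ?_, fun i => by simp⟩
  swap
  · rw [(hb p hp).2.1 a]
    exact Submodule.sum_mem _ fun i _ =>
      Submodule.smul_mem _ _ (Submodule.subset_span (Set.mem_range_self i))
  filter_upwards [hN.mem_nhds hp] with q hq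
  have hNq : ∀ᶠ y in 𝓝[≠] q, y ∈ N := mem_nhdsWithin_of_mem_nhds (hN.mem_nhds hq)
  refine ⟨fun i => meroSec_of_mem ((hb q hq).1 i).mem, hNq.mono hli, fun s => ⟨?_, ?_⟩⟩
  · rintro ⟨u, hu, hsu⟩
    refine ⟨fun i y => c i y (u y), fun i => (hb q hq).2.2.2 i u hu, ?_⟩
    filter_upwards [hNq, hsu] with y hy h1
    rw [h1]
    exact (hb y hy).2.1 (u y)
  · rintro ⟨f, hf, hs⟩
    exact ⟨_, HolSec.sum fun i _ => ((hb q hq).1 i).smul (hf i), hs⟩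

end Frames


section LinearAlgebra

theorem exists_adapted_basis {k : ℕ} (T : Submodule ℂ (Fin k → ℂ)) :
    ∃ (c : Module.Basis (Fin k) ℂ (Fin k → ℂ)) (ε : Fin k → ℤ), (∀ i, ε i = 0 ∨ ε i = 1) ∧
      (∀ v, v ∈ T ↔ ∀ i, ε i = 1 → c.repr v i = 0) ∧
      ∑ i, ε i = Module.finrank ℂ ((Fin k → ℂ) ⧸ T) := by
  let c₀ := Module.Basis.sumQuot (Module.finBasis ℂ T) (Module.finBasis ℂ ((Fin k → ℂ) ⧸ T))
  have hk : Module.finrank ℂ T + Module.finrank ℂ ((Fin k → ℂ) ⧸ T) = k := by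
    have := Module.finrank_eq_card_basis c₀
    simpa using this.symm
  let σ := finSumFinEquiv.trans (finCongr hk)
  refine ⟨c₀.reindex σ, fun i => Sum.elim (fun _ => 0) (fun _ => 1) (σ.symm i), fun i => ?_,
    fun v => ?_, ?_⟩
  · change Sum.elim _ _ (σ.symm i) = 0 ∨ Sum.elim _ _ (σ.symm i) = 1
    generalize σ.symm i = j
    rcases j with j | j <;> simp
  · have h1 : v ∈ T ↔ ∀ j, c₀.repr v (Sum.inr j) = 0 := by
      simp only [c₀, Module.Basis.sumQuot_repr_inr]
      rw [← Submodule.Quotient.mk_eq_zero T,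
        ← (Module.finBasis ℂ ((Fin k → ℂ) ⧸ T)).repr.map_eq_zero_iff,
        Finsupp.ext_iff]
      rfl
    rw [h1]
    constructor
    · intro h i hi
      rw [Module.Basis.repr_reindex_apply]
      rcases hj : σ.symm i with j | j
      · simp [hj] at hi
      · exact h j
    · intro h j
      simpa using h (σ (Sum.inr j)) (by simp)
  · rw [Equiv.sum_comp σ.symm (Sum.elim (fun _ => (0 : ℤ)) fun _ => 1)]
    simp

theorem exists_flag_basis {ι κ V₁ V₂ : Type*} [AddCommGroup V₁] [Module ℂ V₁]
    [AddCommGroup V₂] [Module ℂ V₂] (T : Submodule ℂ (V₁ × V₂))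
    (c₁ : Module.Basis ι ℂ V₁) (ε₁ : ι → ℤ)
    (h₁ : ∀ v, (v, 0) ∈ T ↔ ∀ i, ε₁ i = 1 → c₁.repr v i = 0)
    (c₂ : Module.Basis κ ℂ V₂) (ε₂ : κ → ℤ)
    (h₂ : ∀ v, v ∈ T.map (LinearMap.snd ℂ V₁ V₂) ↔ ∀ i, ε₂ i = 1 → c₂.repr v i = 0) :
    ∃ c : Module.Basis (ι ⊕ κ) ℂ (V₁ × V₂), (∀ i, c (Sum.inl i) = (c₁ i, 0)) ∧
      ∀ v, v ∈ T ↔ ∀ i, Sum.elim ε₁ ε₂ i = 1 → c.repr v i = 0 := by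
  let T₂ := T.map (LinearMap.snd ℂ V₁ V₂)
  obtain ⟨Λ, hΛ⟩ : ∃ Λ : V₂ →ₗ[ℂ] V₁, ∀ t ∈ T₂, (Λ t, t) ∈ T := by
    let g : T →ₗ[ℂ] T₂ := ((LinearMap.snd ℂ V₁ V₂).domRestrict T).codRestrict T₂
      fun t => Submodule.mem_map_of_mem t.2
    have hg : Function.Surjective g := by
      rintro ⟨_, t, ht, rfl⟩
      exact ⟨⟨t, ht⟩, rfl⟩
    obtain ⟨s, hs⟩ := LinearMap.exists_rightInverse_of_surjective g (LinearMap.range_eq_top.2 hg)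
    obtain ⟨Λ, h⟩ := LinearMap.exists_extend ((LinearMap.fst ℂ V₁ V₂) ∘ₗ T.subtype ∘ₗ s)
    refine ⟨Λ, fun t ht => ?_⟩
    have h1 : Λ t = (s ⟨t, ht⟩ : V₁ × V₂).1 := LinearMap.congr_fun h ⟨t, ht⟩
    have h2 : (s ⟨t, ht⟩ : V₁ × V₂).2 = t := congrArg Subtype.val (LinearMap.congr_fun hs ⟨t, ht⟩)
    have h3 : (Λ t, t) = (s ⟨t, ht⟩ : V₁ × V₂) := Prod.ext h1 h2.symm
    rw [h3]
    exact (s ⟨t, ht⟩).2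
  let σ : (V₁ × V₂) ≃ₗ[ℂ] (V₁ × V₂) :=
    { toFun := fun v => (v.1 + Λ v.2, v.2)
      map_add' := fun a b => by ext <;> simp; abel
      map_smul' := fun a b => by ext <;> simp
      invFun := fun v => (v.1 - Λ v.2, v.2)
      left_inv := fun v => by simp
      right_inv := fun v => by simp }
  refine ⟨(c₁.prod c₂).map σ, fun i => by simp [σ], fun v => ?_⟩
  have hr : ∀ i, ((c₁.prod c₂).map σ).repr v i = (c₁.prod c₂).repr (v.1 - Λ v.2, v.2) i :=
    fun i => rfl
  have hT : v ∈ T ↔ (v.1 - Λ v.2, 0) ∈ T ∧ v.2 ∈ T₂ := by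
    have key : (v.1 - Λ v.2, 0) = v - (Λ v.2, v.2) := by ext <;> simp
    rw [key]
    constructor
    · intro hv
      have h2 : v.2 ∈ T₂ := Submodule.mem_map_of_mem hv
      exact ⟨T.sub_mem hv (hΛ _ h2), h2⟩
    · rintro ⟨h1, h2⟩
      simpa using T.add_mem h1 (hΛ _ h2)
  rw [hT, h₁, h₂, Sum.forall]
  simp only [hr, Module.Basis.prod_repr_inl, Module.Basis.prod_repr_inr, Sum.elim_inl,
    Sum.elim_inr]

end LinearAlgebra

section Modification

variable {X : Type u} [TopologicalSpace X] [ChartedSpace ℂ X] {r : ℕ}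
  {E : HolVectorBundle.{u, v} X r} {ι κ : Type*} [Fintype ι] [Fintype κ]

open Classical in
/-- The subsheaf of `𝓖` that agrees with `𝓖` off `x` and whose germs at `x` lie in `P`. -/
noncomputable def restrictAt (𝓖 : SubSheaf E) (x : X) (P : Submodule ℂ (Sec E)) : SubSheaf E :=
  Function.update 𝓖 x (𝓖 x ⊓ P)

theorem restrictAt_self (𝓖 : SubSheaf E) (x : X) (P : Submodule ℂ (Sec E)) :
    restrictAt 𝓖 x P x = 𝓖 x ⊓ P := by simp [restrictAt]

theorem restrictAt_of_ne (𝓖 : SubSheaf E) {x p : X} (P : Submodule ℂ (Sec E)) (h : p ≠ x) :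
    restrictAt 𝓖 x P p = 𝓖 p := by simp [restrictAt, h]

/-- The sections `s` are the transforms of `e` by a square matrix of meromorphic functions whose
determinant has order `m` at `p`. -/
def RelOrd {k : ℕ} (p : X) (e s : Fin k → Sec E) (m : ℤ) : Prop :=
  ∃ A : Fin k → Fin k → X → ℂ, (∀ i j, MeroFun (A i j) p) ∧
    (∀ i, ∀ᶠ y in 𝓝[≠] p, s i y = ∑ j, A i j y • e j y) ∧
    ordFun (fun y => (Matrix.of fun i j => A i j y).det) p = (m : WithTop ℤ)

theorem RelOrd.trans {k : ℕ} {p : X} {e s t : Fin k → Sec E} {m n : ℤ} (h : RelOrd p e s m)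
    (h' : RelOrd p s t n) : RelOrd p e t (m + n) := by
  obtain ⟨A, hA, hs, hm⟩ := h
  obtain ⟨B, hB, ht, hn⟩ := h'
  refine ⟨fun i j y => ∑ l, B i l y * A l j y,
    fun i j => MeroFun.sum fun l _ => (hB i l).mul (hA l j), fun i => ?_, ?_⟩
  · filter_upwards [ht i, eventually_all.2 hs] with y h1 h2
    simp only [h1, h2, Finset.smul_sum, Finset.sum_smul, mul_smul]
    exact Finset.sum_comm
  · have : ∀ y, (Matrix.of fun i j => ∑ l, B i l y * A l j y).det =
        (Matrix.of fun i j => A i j y).det * (Matrix.of fun i j => B i j y).det := by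
      intro y
      rw [mul_comm, ← Matrix.det_mul]
      rfl
    simp only [this]
    rw [ordFun_mul (MeroFun.det hA) (MeroFun.det hB), hm, hn]
    rfl

theorem RelOrd.symm {k : ℕ} {p : X} {e s : Fin k → Sec E} {m : ℤ} (h : RelOrd p e s m) :
    RelOrd p s e (-m) := by
  obtain ⟨A, hA, hs, hm⟩ := h
  have h0 := eventually_ne_zero_of_ordFun (MeroFun.det hA) hm
  let M : X → Matrix (Fin k) (Fin k) ℂ := fun y => Matrix.of fun i j => A i j y
  have hM : ∀ i j, MeroFun (fun y => (M y)⁻¹ i j) p := by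
    intro i j
    simp only [Matrix.inv_def, Ring.inverse_eq_inv', Matrix.smul_apply, smul_eq_mul,
      Matrix.adjugate_apply]
    refine (MeroFun.det hA).inv.mul ?_
    refine MeroFun.det (a := fun a b y => (M y).updateRow j (Pi.single i 1) a b) fun a b => ?_
    simp only [Matrix.updateRow_apply]
    split_ifs
    · exact (HolFun.const _ p).meroFun
    · exact hA a b
  have hdet : MeroFun (fun y => (Matrix.of fun i j => (M y)⁻¹ i j).det) p := MeroFun.det hM
  refine ⟨fun i j y => (M y)⁻¹ i j, hM, fun i => ?_, ?_⟩
  · filter_upwards [eventually_all.2 hs, h0] with y h1 h2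
    have h3 : (M y)⁻¹ * M y = 1 := Matrix.nonsing_inv_mul _ (isUnit_iff_ne_zero.2 h2)
    simp only [h1, Finset.smul_sum, smul_smul]
    rw [Finset.sum_comm]
    simp only [← Finset.sum_smul]
    have h4 : ∀ j, ∑ l, (M y)⁻¹ i l * A l j y = (1 : Matrix (Fin k) (Fin k) ℂ) i j := fun j => by
      rw [← h3]; rfl
    simp [h4, Matrix.one_apply]
  · have h5 : ordFun (fun y => (M y).det * (Matrix.of fun i j => (M y)⁻¹ i j).det) p = 0 := by
      rw [ordFun_congr (g := fun _ => 1)]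
      · exact (HolFun.const 1 p).ordFun_eq_zero one_ne_zero
      · filter_upwards [h0] with y h2
        change (M y).det * ((M y)⁻¹).det = 1
        rw [← Matrix.det_mul, Matrix.mul_nonsing_inv _ (isUnit_iff_ne_zero.2 h2), Matrix.det_one]
    rw [ordFun_mul (MeroFun.det hA) hdet, hm] at h5
    generalize ordFun (fun y => (Matrix.of fun i j => (M y)⁻¹ i j).det) p = t at h5
    cases t with
    | top => simp at h5
    | coe t =>
      norm_cast at h5 ⊢
      omega

theorem StalkFrame.relOrd {k : ℕ} {𝓖 : SubSheaf E} {p : X} {e s : Fin k → Sec E}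
    (he : StalkFrame 𝓖 p e) (hs : StalkFrame 𝓖 p s) : RelOrd p e s 0 := by
  choose a ha has using fun i => (he.2.2 _).1 (hs.mem i)
  choose b hb hbs using fun i => (hs.2.2 _).1 (he.mem i)
  refine ⟨a, fun i j => (ha i j).meroFun, has, (HolFun.det ha).ordFun_eq_zero ?_⟩
  have h1 : ∀ᶠ y in 𝓝[≠] p, (Matrix.of fun i j => b i j y).det *
      (Matrix.of fun i j => a i j y).det = 1 := by
    filter_upwards [he.2.1, eventually_all.2 has, eventually_all.2 hbs] with y h0 h1 h2
    rw [← Matrix.det_mul, ← Matrix.det_one (n := Fin k)]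
    congr 1
    ext i j
    have h3 := Fintype.linearIndependent_iff.1 h0
      (fun j => ∑ l, b i l y * a l j y - (1 : Matrix (Fin k) (Fin k) ℂ) i j) ?_ j
    · exact sub_eq_zero.1 h3
    · have h4 := h2 i
      simp only [h1, Finset.smul_sum, smul_smul] at h4
      rw [Finset.sum_comm] at h4
      simp only [← Finset.sum_smul] at h4
      simp only [sub_smul, Finset.sum_sub_distrib]
      rw [← h4]
      simp [Matrix.one_apply]
  have h2 := ((HolFun.det hb).mul (HolFun.det ha)).eq_of_eventuallyEq (HolFun.const 1 p) h1
  intro h3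
  simp [h3] at h2

/-- The bundles `𝓗` and `𝓗'` of rank `k` agree off `x`, and local frames of theirs at `x` are
related by a matrix whose determinant has order `m`, so that `deg 𝓗' = deg 𝓗 - m`. -/
def Shift (x : X) (k : ℕ) (𝓗 𝓗' : SubSheaf E) (m : ℤ) : Prop :=
  (∀ p, p ≠ x → 𝓗' p = 𝓗 p) ∧
  ∃ e e' : Fin k → Sec E, IsFrame 𝓗 x e ∧ IsFrame 𝓗' x e' ∧ RelOrd x e e' m

theorem Shift.trans {x : X} {k : ℕ} {𝓗 𝓗' 𝓗'' : SubSheaf E} {m n : ℤ} (h : Shift x k 𝓗 𝓗' m)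
    (h' : Shift x k 𝓗' 𝓗'' n) : Shift x k 𝓗 𝓗'' (m + n) := by
  obtain ⟨h1, e, e', he, he', hm⟩ := h
  obtain ⟨h2, f, f', hf, hf', hn⟩ := h'
  refine ⟨fun p hp => (h2 p hp).trans (h1 p hp), e, f', he, hf', ?_⟩
  simpa using (hm.trans (he'.stalkFrame.relOrd hf.stalkFrame)).trans hn

theorem Shift.symm {x : X} {k : ℕ} {𝓗 𝓗' : SubSheaf E} {m : ℤ} (h : Shift x k 𝓗 𝓗' m) :
    Shift x k 𝓗' 𝓗 (-m) := by
  obtain ⟨h1, e, e', he, he', hm⟩ := h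
  exact ⟨fun p hp => (h1 p hp).symm, e', e, he', he, hm.symm⟩

theorem Shift.isDivisorOf [T1Space X] {x : X} {k : ℕ} {𝓗 𝓗' : SubSheaf E} {m : ℤ}
    (h : Shift x k 𝓗 𝓗' m) {s : Fin k → Sec E} {D : X →₀ ℤ} (hD : IsDivisorOf 𝓗 s D) :
    IsDivisorOf 𝓗' s (D + Finsupp.single x (-m)) := by
  classical
  intro p
  obtain ⟨e, a, he, ha⟩ := hD p
  rcases eq_or_ne p x with rfl | hp
  · obtain ⟨h1, f, f', hf, hf', hm⟩ := h
    obtain ⟨b, hb⟩ := (hm.symm.trans (hf.stalkFrame.relOrd he.stalkFrame)).trans ⟨a, ha⟩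
    refine ⟨f', b, hf', ?_⟩
    have h2 : (D + Finsupp.single p (-m)) p = -m + 0 + D p := by simp [add_comm]
    rwa [h2]
  · refine ⟨e, a, he.congr_of_ne hp h.1, ?_⟩
    simpa [Finsupp.single_apply, hp.symm] using ha

theorem Shift.degree_eq [T1Space X] {x : X} {k : ℕ} {𝓗 𝓗' : SubSheaf E} {m : ℤ}
    (h : Shift x k 𝓗 𝓗' m) :
    degree 𝓗' k = degree 𝓗 k - m ∨ degree 𝓗' k = 0 ∧ degree 𝓗 k = 0 := by
  have key : ∀ {𝓗 𝓗' : SubSheaf E} {m : ℤ}, Shift x k 𝓗 𝓗' m → ∀ d,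
      (∃ (s : Fin k → Sec E) (D : X →₀ ℤ), IsDivisorOf 𝓗 s D ∧ d = D.sum fun _ m => m) →
      ∃ (s : Fin k → Sec E) (D : X →₀ ℤ), IsDivisorOf 𝓗' s D ∧ d - m = D.sum fun _ m => m := by
    rintro 𝓗 𝓗' m h d ⟨s, D, hD, rfl⟩
    refine ⟨s, _, h.isDivisorOf hD, ?_⟩
    rw [Finsupp.sum_add_index' (fun _ => rfl) (fun _ _ _ => rfl), Finsupp.sum_single_index rfl]
    ring
  set A := {d | ∃ (s : Fin k → Sec E) (D : X →₀ ℤ), IsDivisorOf 𝓗 s D ∧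
    d = D.sum fun _ m => m} with hA
  set B := {d | ∃ (s : Fin k → Sec E) (D : X →₀ ℤ), IsDivisorOf 𝓗' s D ∧
    d = D.sum fun _ m => m} with hB
  have hAB : ∀ d ∈ A, d - m ∈ B := key h
  have hBA : ∀ d ∈ B, d + m ∈ A := fun d hd => sub_neg_eq_add d m ▸ key h.symm d hd
  change sSup B = sSup A - m ∨ sSup B = 0 ∧ sSup A = 0
  by_cases hgood : A.Nonempty ∧ BddAbove A
  · obtain ⟨hne, hbd⟩ := hgood
    have hneB : B.Nonempty := hne.imp' _ hAB
    have hbdB : BddAbove B := by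
      obtain ⟨M, hM⟩ := hbd
      exact ⟨M - m, fun d hd => by have := hM (hBA d hd); omega⟩
    left
    apply le_antisymm
    · exact csSup_le hneB fun d hd => by have := le_csSup hbd (hBA d hd); omega
    · have : sSup A ≤ sSup B + m :=
        csSup_le hne fun d hd => by have := le_csSup hbdB (hAB d hd); omega
      omega
  · right
    have hgoodB : ¬ (B.Nonempty ∧ BddAbove B) := by
      rintro ⟨hne, M, hM⟩
      exact hgood ⟨hne.imp' _ hBA, M + m, fun d hd => by have := hM (hAB d hd); omega⟩
    have zero : ∀ C : Set ℤ, ¬ (C.Nonempty ∧ BddAbove C) → sSup C = 0 := by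
      intro C hC
      by_cases hne : C.Nonempty
      · rw [csSup_of_not_bddAbove fun hb => hC ⟨hne, hb⟩, Int.csSup_empty]
      · rw [Set.not_nonempty_iff_eq_empty.1 hne, Int.csSup_empty]
    exact ⟨zero B hgoodB, zero A hgood⟩

theorem IsSubbundle.le {𝓗 𝓖 : SubSheaf E} {k : ℕ} (h : IsSubbundle 𝓗 𝓖 k) (p : X) :
    𝓗 p ≤ 𝓖 p := by
  obtain ⟨m, e, e', he, he'⟩ := h p
  intro s hs
  obtain ⟨f, hf, hsf⟩ := (he.stalkFrame.2.2 s).1 hs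
  refine (he'.stalkFrame.2.2 s).2 ⟨Sum.elim f fun _ _ => 0, ?_, hsf.mono fun y hy => by simp [hy]⟩
  rintro (i | i)
  · exact hf i
  · exact HolFun.const 0 p

theorem isSubbundle_self {𝓖 : SubSheaf E} {k : ℕ} : IsSubbundle 𝓖 𝓖 k ↔ IsLocallyFree 𝓖 k := by
  refine ⟨fun h p => ?_, fun h p => ?_⟩
  · obtain ⟨m, e, e', he, he'⟩ := h p
    exact ⟨e, he⟩
  · obtain ⟨e, he⟩ := h p
    refine ⟨0, e, Fin.elim0, he, ?_⟩
    filter_upwards [isFrame_iff.1 he] with q hq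
    refine ⟨?_, ?_, fun s => ?_⟩
    · rintro (i | i)
      · exact hq.1 i
      · exact i.elim0
    · filter_upwards [hq.2.1] with y hy
      rw [Fintype.linearIndependent_iff] at hy ⊢
      intro g hg
      rintro (i | i)
      · exact hy (fun i => g (Sum.inl i)) (by simpa using hg) i
      · exact i.elim0
    · rw [hq.2.2 s]
      constructor
      · rintro ⟨f, hf, hs⟩
        refine ⟨Sum.elim f fun _ _ => 0, ?_, by simpa using hs⟩
        rintro (i | i)
        · exact hf i
        · exact i.elim0
      · rintro ⟨f, hf, hs⟩
        exact ⟨fun i => f (Sum.inl i), fun i => hf _, by simpa using hs⟩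

theorem vanishing_mono {𝓗 𝓖 : SubSheaf E} {x : X} (h : 𝓗 x ≤ 𝓖 x) :
    vanishing 𝓗 x ≤ vanishing 𝓖 x := by
  rintro s ⟨u, hu, hs⟩
  exact ⟨u, h hu, hs⟩

variable [IsManifold 𝓘(ℂ) ω X]

theorem IsFrame.restrictAt {𝓖 : SubSheaf E} {x : X} {e : ι → Sec E} (he : IsFrame 𝓖 x e)
    {P : Submodule ℂ (Sec E)} (hP : vanishing 𝓖 x ≤ P) (c : Module.Basis κ ℂ (ι → ℂ))
    {ε : κ → ℤ} (hε : ∀ i, ε i = 0 ∨ ε i = 1)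
    (hc : ∀ v, Fintype.linearCombination ℂ e v ∈ P ↔ ∀ k, ε k = 1 → c.repr v k = 0) :
    IsFrame (restrictAt 𝓖 x P) x fun k y => coord x y ^ ε k • ∑ i, c k i • e i y := by
  refine (he.basis_change c).coord_zpow_smul ε (fun q hq => restrictAt_of_ne _ _ hq) fun s => ?_
  have he' := he.stalkFrame
  have hce := (he.basis_change c).stalkFrame
  rw [restrictAt_self, Submodule.mem_inf]
  constructor
  · rintro ⟨hs, hsP⟩
    obtain ⟨f, hf, hsf⟩ := (he'.2.2 s).1 hs
    rw [he'.mem_iff_of_vanishing_le hP hf hsf, hc] at hsP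
    have h1 : ∀ k, ∃ g : X → ℂ, HolFun g x ∧
        ∀ᶠ y in 𝓝[≠] x, c.repr (fun i => f i y) k = g y * coord x y ^ ε k := by
      intro k
      have hk := StalkFrame.holFun_repr c hf k
      rcases hε k with h0 | h0
      · exact ⟨_, hk, Eventually.of_forall fun y => by simp [h0]⟩
      · obtain ⟨g, hg, hg'⟩ := hk.exists_eq_coord_mul (hsP k h0)
        exact ⟨g, hg, (hg'.filter_mono nhdsWithin_le_nhds).mono fun y hy => by
          rw [hy, h0, zpow_one, mul_comm]⟩
    choose g hg hg' using h1
    refine ⟨g, hg, ?_⟩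
    filter_upwards [hsf, eventually_all.2 hg'] with y h1 h2
    simp only [← h2, StalkFrame.sum_repr_smul, h1]
  · rintro ⟨g, hg, hsg⟩
    have hz : ∀ k, HolFun (fun y => g k y * coord x y ^ ε k) x := fun k => by
      refine (hg k).mul ?_
      rcases hε k with h0 | h0 <;> simp only [h0, zpow_one, zpow_zero]
      · exact HolFun.const _ _
      · exact holFun_coord x
    have hs : s ∈ 𝓖 x := (hce.2.2 s).2 ⟨_, hz, hsg⟩
    refine ⟨hs, ?_⟩
    rw [hce.mem_iff_of_vanishing_le hP hz hsg]
    have h3 : Fintype.linearCombination ℂ (fun k y => ∑ i, c k i • e i y)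
        (fun k => g k x * coord x x ^ ε k) = Fintype.linearCombination ℂ e
          (∑ k, (g k x * coord x x ^ ε k) • c k) := by
      ext y
      simp only [Fintype.linearCombination_apply, Finset.sum_apply, Pi.smul_apply, smul_eq_mul,
        Finset.smul_sum, Finset.sum_smul, mul_smul]
      exact Finset.sum_comm
    rw [h3, hc]
    intro k hk
    rw [c.repr_sum_self]
    simp [hk]

theorem StalkFrame.finrank_quotient {𝓗 : SubSheaf E} {x : X} {e : ι → Sec E}
    (he : StalkFrame 𝓗 x e) {P : Submodule ℂ (Sec E)} (hP : vanishing 𝓗 x ≤ P) :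
    Module.finrank ℂ ((ι → ℂ) ⧸ P.comap (Fintype.linearCombination ℂ e)) =
      Module.finrank ℂ (𝓗 x ⧸ P.comap (𝓗 x).subtype) := by
  let g : (ι → ℂ) →ₗ[ℂ] 𝓗 x ⧸ P.comap (𝓗 x).subtype := (P.comap (𝓗 x).subtype).mkQ ∘ₗ
    (Fintype.linearCombination ℂ e).codRestrict (𝓗 x) he.linearCombination_mem
  have hg : Function.Surjective g := by
    intro s
    obtain ⟨⟨s, hs⟩, rfl⟩ := Submodule.mkQ_surjective _ s
    obtain ⟨f, hf, hsf⟩ := (he.2.2 s).1 hs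
    refine ⟨fun i => f i x, ?_⟩
    simp only [g, LinearMap.comp_apply, Submodule.mkQ_apply]
    rw [eq_comm, Submodule.Quotient.eq]
    exact hP (he.sub_linearCombination_mem_vanishing hf hsf)
  have hk : LinearMap.ker g = P.comap (Fintype.linearCombination ℂ e) := by
    ext v
    simp [g]
  rw [← hk]
  exact (g.quotKerEquivOfSurjective hg).finrank_eq

theorem IsSubbundle.restrictAt [T1Space X] {𝓗 𝓖 : SubSheaf E} {k : ℕ} (h : IsSubbundle 𝓗 𝓖 k)
    {x : X} {P : Submodule ℂ (Sec E)} (hP : vanishing 𝓖 x ≤ P) :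
    IsSubbundle (restrictAt 𝓗 x P) (restrictAt 𝓖 x P) k ∧
      Shift x k 𝓗 (Hecke.restrictAt 𝓗 x P)
        (Module.finrank ℂ (𝓗 x ⧸ P.comap (𝓗 x).subtype)) := by
  have hP' : vanishing 𝓗 x ≤ P := (vanishing_mono (h.le x)).trans hP
  obtain ⟨m, e, e', he, hee⟩ := h x
  obtain ⟨c₁, ε₁, hε₁, hc₁, hsum⟩ :=
    exists_adapted_basis (P.comap (Fintype.linearCombination ℂ e))
  have hf := he.restrictAt hP' c₁ hε₁ hc₁
  let σ := LinearEquiv.sumArrowLequivProdArrow (Fin k) (Fin m) ℂ ℂ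
  let T := P.comap (Fintype.linearCombination ℂ (Sum.elim e e'))
  obtain ⟨c₂, ε₂, hε₂, hc₂, -⟩ :=
    exists_adapted_basis ((T.map σ.toLinearMap).map (LinearMap.snd ℂ (Fin k → ℂ) (Fin m → ℂ)))
  obtain ⟨c, hcl, hc⟩ := exists_flag_basis (T.map σ.toLinearMap) c₁ ε₁ (fun v => by
    rw [← hc₁ v]
    simp only [Submodule.mem_map_equiv, T, Submodule.mem_comap]
    have : Fintype.linearCombination ℂ (Sum.elim e e') (σ.symm (v, 0)) =
        Fintype.linearCombination ℂ e v := by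
      ext y
      simp [σ, Fintype.linearCombination_apply]
    rw [this]) c₂ ε₂ hc₂
  have hg := hee.restrictAt hP (c.map σ.symm) (ε := Sum.elim ε₁ ε₂) (by
    rintro (i | i)
    · exact hε₁ i
    · exact hε₂ i) (fun v => by
    have := hc (σ v)
    simp only [Submodule.mem_map_equiv, LinearEquiv.symm_apply_apply, T,
      Submodule.mem_comap] at this
    rw [this]
    rfl)
  constructor
  · intro p
    rcases eq_or_ne p x with rfl | hp
    · refine ⟨m, _, fun j => fun y => coord p y ^ ε₂ j • ∑ i, (c.map σ.symm) (Sum.inr j) i •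
        Sum.elim e e' i y, hf, ?_⟩
      convert hg using 1
      ext i y
      rcases i with i | i
      · simp [hcl, σ]
      · simp
    · obtain ⟨m', f, f', hf, hff⟩ := h p
      exact ⟨m', f, f', hf.congr_of_ne hp fun q hq => restrictAt_of_ne _ _ hq,
        hff.congr_of_ne hp fun q hq => restrictAt_of_ne _ _ hq⟩
  · refine ⟨fun p hp => restrictAt_of_ne _ _ hp, e, _, he, hf,
      fun i j y => coord x y ^ ε₁ i * c₁ i j, fun i j =>
        (meroFun_coord_zpow x _).mul (HolFun.const _ x).meroFun, fun i => ?_, ?_⟩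
    · exact Eventually.of_forall fun y => by simp only [Finset.smul_sum, mul_smul]
    · have h1 : ∀ᶠ y in 𝓝[≠] x, (Matrix.of fun i j => coord x y ^ ε₁ i * c₁ i j).det =
          coord x y ^ (∑ i, ε₁ i) * (Matrix.of fun i j => c₁ i j).det := by
        filter_upwards [eventually_coord_ne_zero x] with y hy
        refine (Matrix.det_mul_column (fun i => coord x y ^ ε₁ i)
          (Matrix.of fun i j => c₁ i j)).trans ?_
        congr 1
        classical
        induction (Finset.univ : Finset (Fin k)) using Finset.induction_on with
        | empty => simp
        | insert a s ha ih => rw [Finset.prod_insert ha, Finset.sum_insert ha, ih, zpow_add₀ hy]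
      rw [ordFun_congr h1, ordFun_mul (meroFun_coord_zpow x _) (HolFun.const _ x).meroFun,
        ordFun_coord_zpow, (HolFun.const _ x).ordFun_eq_zero, add_zero, hsum,
        he.stalkFrame.finrank_quotient hP']
      have := Matrix.linearIndependent_rows_iff_isUnit.1 c₁.linearIndependent
      exact ((Matrix.isUnit_iff_isUnit_det _).1 this).ne_zero

theorem IsFrame.twist {𝓖 : SubSheaf E} {x : X} {e : ι → Sec E} (he : IsFrame 𝓖 x e) :
    IsFrame (twist 𝓖 x) x fun i y => coord x y ^ (-1 : ℤ) • e i y := by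
  refine he.coord_zpow_smul (fun _ => -1) (fun q hq => twist_of_ne hq) fun s => ?_
  rw [mem_twist_self, he.stalkFrame.2.2]
  refine exists_congr fun f => and_congr_right fun _ => eventually_congr ?_
  filter_upwards [eventually_coord_ne_zero x] with y hy
  rw [← smul_right_inj (inv_ne_zero hy), inv_smul_smul₀ hy, Finset.smul_sum]
  simp only [zpow_neg_one, smul_smul, mul_comm]

theorem IsSubbundle.twist [T1Space X] {𝓗 𝓖 : SubSheaf E} {k : ℕ} (h : IsSubbundle 𝓗 𝓖 k)
    (x : X) : IsSubbundle (twist 𝓗 x) (twist 𝓖 x) k ∧ Shift x k 𝓗 (Hecke.twist 𝓗 x) (-k) := by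
  constructor
  · intro p
    obtain ⟨m, e, e', he, he'⟩ := h p
    rcases eq_or_ne p x with rfl | hp
    · refine ⟨m, _, fun i y => coord p y ^ (-1 : ℤ) • e' i y, he.twist, ?_⟩
      convert he'.twist using 1
      ext i y
      rcases i with i | i <;> rfl
    · exact ⟨m, e, e', he.congr_of_ne hp fun q hq => twist_of_ne hq,
        he'.congr_of_ne hp fun q hq => twist_of_ne hq⟩
  · obtain ⟨m, e, e', he, he'⟩ := h x
    refine ⟨fun p hp => twist_of_ne hp, e, _, he, he.twist,
      fun i j y => coord x y ^ (-1 : ℤ) * (1 : Matrix (Fin k) (Fin k) ℂ) i j, fun i j =>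
        (meroFun_coord_zpow x _).mul (HolFun.const _ x).meroFun, fun i => ?_, ?_⟩
    · exact Eventually.of_forall fun y => by simp [Matrix.one_apply]
    · have h1 : ∀ y, (Matrix.of fun i j => coord x y ^ (-1 : ℤ) *
          (1 : Matrix (Fin k) (Fin k) ℂ) i j).det = coord x y ^ (-k : ℤ) := by
        intro y
        rw [Matrix.det_mul_column (fun i => coord x y ^ (-1 : ℤ)) 1]
        change _ * (1 : Matrix (Fin k) (Fin k) ℂ).det = _
        simp
      simp only [h1, ordFun_coord_zpow]

end Modification


section Germs

variable {X : Type u} [TopologicalSpace X] [ChartedSpace ℂ X] {r : ℕ}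
  {E : HolVectorBundle.{u, v} X r}

/-- The value at `p` of a germ of a holomorphic section. -/
noncomputable def germValue (E : HolVectorBundle.{u, v} X r) (p : X) :
    holSheaf E p →ₗ[ℂ] E.fiber p where
  toFun s := (mem_holSheaf.1 s.2).choose p
  map_add' s t := by
    have h1 := (mem_holSheaf.1 s.2).choose_spec
    have h2 := (mem_holSheaf.1 t.2).choose_spec
    have h3 := (mem_holSheaf.1 (s + t).2).choose_spec
    refine HolSec.eq_of_eventuallyEq h3.1 (h1.1.add h2.1) ?_
    filter_upwards [h1.2, h2.2, h3.2] with y e1 e2 e3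
    rw [← e3, Pi.add_apply, ← e1, ← e2]
    rfl
  map_smul' c s := by
    have h1 := (mem_holSheaf.1 s.2).choose_spec
    have h3 := (mem_holSheaf.1 (c • s).2).choose_spec
    refine HolSec.eq_of_eventuallyEq h3.1 (h1.1.smul (HolFun.const c p)) ?_
    filter_upwards [h1.2, h3.2] with y e1 e3
    rw [← e3, ← e1]
    rfl

theorem germValue_eq {p : X} {s u : Sec E} (hs : s ∈ holSheaf E p) (hu : HolSec E u p)
    (h : ∀ᶠ y in 𝓝[≠] p, s y = u y) : germValue E p ⟨s, hs⟩ = u p := by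
  have hs' := (mem_holSheaf.1 hs).choose_spec
  refine HolSec.eq_of_eventuallyEq hs'.1 hu ?_
  filter_upwards [h, hs'.2] with y h1 h2
  exact h2.symm.trans h1

theorem germValue_surjective (p : X) : Function.Surjective (germValue E p) := fun a => by
  obtain ⟨u, hu, rfl⟩ := exists_holSec_eq p a
  exact ⟨⟨u, hu.mem⟩, germValue_eq hu.mem hu (Eventually.of_forall fun _ => rfl)⟩

/-- The germs at `x` of holomorphic sections whose value at `x` lies in `U`. -/
noncomputable def valuesIn (E : HolVectorBundle.{u, v} X r) (x : X)
    (U : Submodule ℂ (E.fiber x)) : Submodule ℂ (Sec E) :=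
  (U.comap (germValue E x)).map (holSheaf E x).subtype

theorem mem_valuesIn {x : X} {U : Submodule ℂ (E.fiber x)} {s : Sec E} :
    s ∈ valuesIn E x U ↔
      ∃ u : Sec E, HolSec E u x ∧ u x ∈ U ∧ ∀ᶠ y in 𝓝[≠] x, s y = u y := by
  constructor
  · rintro ⟨⟨s, hs'⟩, hs, rfl⟩
    obtain ⟨u, hu, hsu⟩ := mem_holSheaf.1 hs'
    refine ⟨u, hu, ?_, hsu⟩
    rwa [SetLike.mem_coe, Submodule.mem_comap, germValue_eq _ hu hsu] at hs
  · rintro ⟨u, hu, hux, hsu⟩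
    refine ⟨⟨s, mem_holSheaf.2 ⟨u, hu, hsu⟩⟩, ?_, rfl⟩
    rwa [SetLike.mem_coe, Submodule.mem_comap, germValue_eq _ hu hsu]

theorem valuesIn_le {x : X} {U : Submodule ℂ (E.fiber x)} : valuesIn E x U ≤ holSheaf E x :=
  Submodule.map_subtype_le _ _

theorem finrank_quotient_valuesIn {x : X} (U : Submodule ℂ (E.fiber x)) :
    Module.finrank ℂ (holSheaf E x ⧸ (valuesIn E x U).comap (holSheaf E x).subtype) +
      Module.finrank ℂ U = r := by
  have h1 : (valuesIn E x U).comap (holSheaf E x).subtype =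
      LinearMap.ker (U.mkQ ∘ₗ germValue E x) := by
    rw [valuesIn, Submodule.comap_map_eq_of_injective (Submodule.subtype_injective _),
      LinearMap.ker_comp, Submodule.ker_mkQ]
  have h2 : Function.Surjective (U.mkQ ∘ₗ germValue E x) :=
    U.mkQ_surjective.comp (germValue_surjective x)
  rw [h1, (LinearMap.quotKerEquivOfSurjective _ h2).finrank_eq,
    Submodule.finrank_quotient_add_finrank, finrank_fiber]

theorem vanishing_holSheaf_le_valuesIn [IsManifold 𝓘(ℂ) ω X] {x : X}
    {U : Submodule ℂ (E.fiber x)} : vanishing (holSheaf E) x ≤ valuesIn E x U := by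
  rintro s ⟨u, ⟨w, hw, huw⟩, hsu⟩
  refine mem_valuesIn.2 ⟨_, hw.smul (holFun_coord x), by simp, ?_⟩
  filter_upwards [huw, hsu] with y h1 h2
  rw [h2, h1]

theorem vanishing_twist {𝓖 : SubSheaf E} {x : X}
    (h : ∀ s ∈ 𝓖 x, ∀ t : Sec E, (∀ᶠ y in 𝓝[≠] x, t y = s y) → t ∈ 𝓖 x) :
    vanishing (twist 𝓖 x) x = 𝓖 x := by
  ext s
  constructor
  · rintro ⟨u, hu, hsu⟩
    exact h _ (mem_twist_self.1 hu) s hsu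
  · intro hs
    refine ⟨fun y => (coord x y)⁻¹ • s y, mem_twist_self.2 (h s hs _ ?_), ?_⟩ <;>
    · filter_upwards [eventually_coord_ne_zero x] with y hy
      rw [smul_inv_smul₀ hy]

/-! ### The first transform -/

theorem heckeUp_of_ne [T1Space X] [IsManifold 𝓘(ℂ) ω X] {x p : X} (hp : p ≠ x)
    (V : Submodule ℂ (Module.Dual ℂ (E.fiber x))) : heckeUp E x V p = holSheaf E p := by
  ext s
  constructor
  · rintro ⟨-, hs⟩
    obtain ⟨N, b, c, hN, hpN, hb⟩ := exists_dual_frames E p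
    choose g hg hsg using fun i => hs (c i) ⟨(hb p hpN).2.2.2 i, fun h => (hp h).elim⟩
    refine ⟨fun y => ∑ i, g i y • b i y, HolSec.sum fun i _ => ((hb p hpN).1 i).smul (hg i), ?_⟩
    filter_upwards [eventually_all.2 hsg, mem_nhdsWithin_of_mem_nhds (hN.mem_nhds hpN)] with y h1 h2
    rw [(hb y h2).2.1 (s y)]
    simp only [h1]
  · rintro ⟨u, hu, hsu⟩
    refine ⟨meroSec_of_mem ⟨u, hu, hsu⟩, fun ξ hξ => ⟨_, hξ.1 u hu, ?_⟩⟩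
    filter_upwards [hsu] with y hy
    rw [hy]

theorem mem_heckeUp_self [IsManifold 𝓘(ℂ) ω X] {x : X} {U : Submodule ℂ (E.fiber x)}
    {s : Sec E} : s ∈ heckeUp E x U.dualAnnihilator x ↔
      (fun y => coord x y • s y) ∈ valuesIn E x U := by
  rw [mem_valuesIn]
  constructor
  · rintro ⟨-, hs⟩
    obtain ⟨N, b, c, hN, hxN, hb⟩ := exists_dual_frames E x
    choose g hg hsg using fun i => hs (fun y => coord x y • c i y)
      ⟨fun u hu => (holFun_coord x).mul ((hb x hxN).2.2.2 i u hu), fun _ => by simp⟩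
    let u : Sec E := fun y => ∑ i, g i y • b i y
    have hu : HolSec E u x := HolSec.sum fun i _ => ((hb x hxN).1 i).smul (hg i)
    have hsu : ∀ᶠ y in 𝓝[≠] x, coord x y • s y = u y := by
      filter_upwards [eventually_all.2 hsg, mem_nhdsWithin_of_mem_nhds (hN.mem_nhds hxN)]
        with y h1 h2
      rw [(hb y h2).2.1 (coord x y • s y)]
      simp only [u, ← h1, map_smul, LinearMap.smul_apply]
    refine ⟨u, hu, ?_, hsu⟩
    rw [← Subspace.dualAnnihilator_dualCoannihilator_eq (W := U), Submodule.mem_dualCoannihilator]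
    intro ξ hξ
    obtain ⟨η, hη, rfl⟩ := exists_holDualSec_eq E x ξ
    obtain ⟨f, hf, hsf⟩ := hs η ⟨hη, fun _ => hξ⟩
    have := (hη u hu).eq_of_eventuallyEq ((holFun_coord x).mul hf) (by
      filter_upwards [hsu, hsf] with y h1 h2
      rw [← h1, map_smul, h2, smul_eq_mul])
    simpa using this
  · rintro ⟨u, hu, hux, hsu⟩
    refine ⟨⟨1, u, hu, by simpa using hsu⟩, fun ξ hξ => ?_⟩
    obtain ⟨g, hg, h⟩ := HolFun.exists_eq_coord_mul (hξ.1 u hu)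
      ((Submodule.mem_dualAnnihilator _).1 (hξ.2 rfl) _ hux)
    refine ⟨g, hg, ?_⟩
    filter_upwards [hsu, h.filter_mono nhdsWithin_le_nhds, eventually_coord_ne_zero x]
      with y h1 h2 h3
    rw [← h1, map_smul, smul_eq_mul] at h2
    exact mul_left_cancel₀ h3 h2

theorem heckeUp_eq_twist [T1Space X] [IsManifold 𝓘(ℂ) ω X] {x : X}
    {U : Submodule ℂ (E.fiber x)} : heckeUp E x U.dualAnnihilator =
      twist (restrictAt (holSheaf E) x (valuesIn E x U)) x := by
  funext p
  rcases eq_or_ne p x with rfl | hp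
  · ext s
    rw [mem_heckeUp_self, mem_twist_self, restrictAt_self, inf_eq_right.2 valuesIn_le]
  · rw [heckeUp_of_ne hp, twist_of_ne hp, restrictAt_of_ne _ _ hp]

theorem heckeUp_isSubbundle [T1Space X] [IsManifold 𝓘(ℂ) ω X] {x : X}
    (U : Submodule ℂ (E.fiber x)) :
    IsSubbundle (heckeUp E x U.dualAnnihilator) (heckeUp E x U.dualAnnihilator) r ∧
      Shift x r (holSheaf E) (heckeUp E x U.dualAnnihilator) (-Module.finrank ℂ U) := by
  have h0 : IsSubbundle (holSheaf E) (holSheaf E) r := isSubbundle_self.2 fun p => by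
    obtain ⟨b, hb, -⟩ := exists_isFrame_holSheaf E p
    exact ⟨b, hb⟩
  obtain ⟨h1, h2⟩ := h0.restrictAt (vanishing_holSheaf_le_valuesIn (x := x) (U := U))
  obtain ⟨h3, h4⟩ := h1.twist x
  rw [heckeUp_eq_twist]
  refine ⟨h3, ?_⟩
  have h5 := h2.trans h4
  have h6 := finrank_quotient_valuesIn U
  have h7 : (-Module.finrank ℂ U : ℤ) = Module.finrank ℂ
      (holSheaf E x ⧸ (valuesIn E x U).comap (holSheaf E x).subtype) + -r := by omega
  rwa [h7]

/-- The value at `x` of `z s`, for a germ `s` of `F` and the local coordinate `z`. -/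
noncomputable def residueMap [IsManifold 𝓘(ℂ) ω X] (x : X) (U : Submodule ℂ (E.fiber x)) :
    heckeUp E x U.dualAnnihilator x →ₗ[ℂ] E.fiber x :=
  germValue E x ∘ₗ
  { toFun := fun s => ⟨fun y => coord x y • s.1 y, valuesIn_le (mem_heckeUp_self.1 s.2)⟩
    map_add' := fun s t => by ext y; exact smul_add _ _ _
    map_smul' := fun c s => by ext y; exact smul_comm _ _ _ }

theorem residueMap_eq [IsManifold 𝓘(ℂ) ω X] {x : X} {U : Submodule ℂ (E.fiber x)}
    (s : heckeUp E x U.dualAnnihilator x) {u : Sec E} (hu : HolSec E u x)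
    (h : ∀ᶠ y in 𝓝[≠] x, coord x y • s.1 y = u y) : residueMap x U s = u x :=
  germValue_eq _ hu h

theorem range_residueMap [IsManifold 𝓘(ℂ) ω X] {x : X} {U : Submodule ℂ (E.fiber x)} :
    LinearMap.range (residueMap x U) = U := by
  apply le_antisymm
  · rintro _ ⟨s, rfl⟩
    obtain ⟨u, hu, hux, hsu⟩ := mem_valuesIn.1 (mem_heckeUp_self.1 s.2)
    rwa [residueMap_eq s hu hsu]
  · intro a ha
    obtain ⟨u, hu, rfl⟩ := exists_holSec_eq x a
    have h : ∀ᶠ y in 𝓝[≠] x, coord x y • (coord x y)⁻¹ • u y = u y := by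
      filter_upwards [eventually_coord_ne_zero x] with y hy
      rw [smul_inv_smul₀ hy]
    exact ⟨⟨fun y => (coord x y)⁻¹ • u y, mem_heckeUp_self.2 (mem_valuesIn.2 ⟨u, hu, ha, h⟩)⟩,
      residueMap_eq _ hu h⟩

theorem mem_ker_residueMap [IsManifold 𝓘(ℂ) ω X] {x : X} {U : Submodule ℂ (E.fiber x)}
    {s : heckeUp E x U.dualAnnihilator x} : residueMap x U s = 0 ↔ s.1 ∈ holSheaf E x := by
  obtain ⟨u, hu, hux, hsu⟩ := mem_valuesIn.1 (mem_heckeUp_self.1 s.2)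
  rw [residueMap_eq s hu hsu]
  constructor
  · intro h0
    obtain ⟨w, hw, huw⟩ := hu.exists_eq_coord_smul h0
    refine ⟨w, hw, ?_⟩
    filter_upwards [hsu, huw.filter_mono nhdsWithin_le_nhds, eventually_coord_ne_zero x]
      with y h1 h2 h3
    rw [h2] at h1
    exact smul_right_injective _ h3 h1
  · rintro ⟨w, hw, hsw⟩
    have := hu.eq_of_eventuallyEq (hw.smul (holFun_coord x)) (by
      filter_upwards [hsu, hsw] with y h1 h2
      rw [← h1, h2])
    simpa using this

theorem holSheaf_le_heckeUp [IsManifold 𝓘(ℂ) ω X] {x : X} {U : Submodule ℂ (E.fiber x)} :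
    holSheaf E x ≤ heckeUp E x U.dualAnnihilator x := by
  rintro s ⟨u, hu, hsu⟩
  rw [mem_heckeUp_self, mem_valuesIn]
  exact ⟨_, hu.smul (holFun_coord x), by simp, hsu.mono fun y hy => by rw [hy]⟩

theorem finrank_heckeUp_quotient [IsManifold 𝓘(ℂ) ω X] {x : X} (U : Submodule ℂ (E.fiber x)) :
    FiniteDimensional ℂ (heckeUp E x U.dualAnnihilator x ⧸
      (holSheaf E x).comap (heckeUp E x U.dualAnnihilator x).subtype) ∧
    Module.finrank ℂ (heckeUp E x U.dualAnnihilator x ⧸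
      (holSheaf E x).comap (heckeUp E x U.dualAnnihilator x).subtype) = Module.finrank ℂ U := by
  have h1 : (holSheaf E x).comap (heckeUp E x U.dualAnnihilator x).subtype =
      LinearMap.ker (residueMap x U) := by
    ext s
    rw [LinearMap.mem_ker, mem_ker_residueMap]
    rfl
  have e := (residueMap x U).quotKerEquivRange
  rw [h1]
  refine ⟨Module.Finite.equiv e.symm, ?_⟩
  rw [e.finrank_eq, range_residueMap]

end Germs


section Forms

variable {X : Type u} [TopologicalSpace X] [ChartedSpace ℂ X] {r : ℕ}
  {E : HolVectorBundle.{u, v} X r} {L : HolVectorBundle.{u, w} X 1}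

theorem exists_isotropic_of_dual (φ : OrthogonalForm E L) {x : X}
    {W : Submodule ℂ (Module.Dual ℂ (E.fiber x))} (hW : φ.IsIsotropicDual x W) :
    ∃ U : Submodule ℂ (E.fiber x), Module.finrank ℂ U = Module.finrank ℂ W ∧
      (∀ a ∈ U, ∀ b ∈ U, φ.form x a b = 0) ∧ φ.perp x W = U.dualAnnihilator := by
  have hL : Module.finrank ℂ (L.fiber x) = 1 := finrank_fiber x
  obtain ⟨l, hl0, hl⟩ := finrank_eq_one_iff'.1 hL
  let ψ := LinearEquiv.ofBijective (φ.form x) (φ.nondegenerate x)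
  let τ : Module.Dual ℂ (E.fiber x) →ₗ[ℂ] E.fiber x :=
    ψ.symm.toLinearMap ∘ₗ LinearMap.smulRightₗ.flip l
  have hτ : ∀ ξ b, φ.form x (τ ξ) b = ξ b • l := fun ξ b => by
    have : ψ (τ ξ) = LinearMap.smulRightₗ ξ l := ψ.apply_symm_apply _
    exact LinearMap.congr_fun this b
  have hinv : ∀ ξ η, φ.inverseForm x ξ η = 0 ↔ η (τ ξ) = 0 := fun ξ η => by
    constructor
    · intro h
      exact LinearMap.congr_fun h l
    · intro h
      ext m
      obtain ⟨c, rfl⟩ := hl m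
      rw [map_smul]
      change c • η (τ ξ) = 0
      rw [h, smul_zero]
  have hinj : Function.Injective τ := by
    rw [← LinearMap.ker_eq_bot, LinearMap.ker_eq_bot']
    intro ξ hξ
    ext b
    have := hτ ξ b
    rw [hξ, map_zero, LinearMap.zero_apply, eq_comm, smul_eq_zero] at this
    exact this.resolve_right hl0
  refine ⟨W.map τ, (Submodule.equivMapOfInjective τ hinj W).finrank_eq.symm, ?_, ?_⟩
  · rintro _ ⟨ξ, hξ, rfl⟩ _ ⟨η, hη, rfl⟩
    rw [hτ, (hinv η ξ).1 (hW η hη ξ hξ), zero_smul]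
  · ext η
    rw [Submodule.mem_dualAnnihilator]
    constructor
    · rintro h _ ⟨ξ, hξ, rfl⟩
      exact (hinv ξ η).1 (h ξ hξ)
    · intro h ξ hξ
      exact (hinv ξ η).2 (h _ (Submodule.mem_map_of_mem hξ))

theorem OrthogonalForm.holSec_onSec (φ : OrthogonalForm E L) {s t : Sec E} {p : X}
    (hs : HolSec E s p) (ht : HolSec E t p) : HolSec L (φ.onSec s t) p :=
  φ.holomorphic p s t hs ht

theorem OrthogonalForm.onSec_mem_holSheaf (φ : OrthogonalForm E L) {s t : Sec E} {p : X}
    (hs : s ∈ holSheaf E p) (ht : t ∈ holSheaf E p) : φ.onSec s t ∈ holSheaf L p := by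
  obtain ⟨u, hu, hsu⟩ := mem_holSheaf.1 hs
  obtain ⟨v, hv, htv⟩ := mem_holSheaf.1 ht
  refine mem_holSheaf.2 ⟨_, φ.holSec_onSec hu hv, ?_⟩
  filter_upwards [hsu, htv] with y h1 h2
  simp only [onSec, h1, h2]

theorem vanishing_twist_holSheaf (L : HolVectorBundle.{u, w} X 1) (x : X) :
    vanishing (twist (holSheaf L) x) x = holSheaf L x :=
  vanishing_twist fun _ hs _ h => holSheaf_congr hs h

theorem evalModRadical_surjective (φ : OrthogonalForm E L) (𝓖 : SubSheaf E) (𝓛 : SubSheaf L)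
    (p : X) : Function.Surjective (evalModRadical φ 𝓖 𝓛 p) :=
  (Submodule.mkQ_surjective _).comp (Submodule.mkQ_surjective _)

theorem evalModRadical_of_vanishing (φ : OrthogonalForm E L) (𝓖 : SubSheaf E) (𝓛 : SubSheaf L)
    {p : X} {s : 𝓖 p} (hs : s.1 ∈ vanishing 𝓖 p) : evalModRadical φ 𝓖 𝓛 p s = 0 := by
  have : evalAt 𝓖 p s = 0 := (Submodule.Quotient.mk_eq_zero _).2 hs
  rw [LinearMap.comp_apply, this, map_zero]

theorem evalModRadical_eq_zero_iff (φ : OrthogonalForm E L) {𝓖 : SubSheaf E} {𝓛 : SubSheaf L}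
    {p : X} (hval : ∀ s ∈ 𝓖 p, ∀ t ∈ 𝓖 p, φ.onSec s t ∈ 𝓛 p) {s : 𝓖 p} :
    evalModRadical φ 𝓖 𝓛 p s = 0 ↔ ∀ t ∈ 𝓖 p, φ.onSec s.1 t ∈ vanishing 𝓛 p := by
  rw [LinearMap.comp_apply, Submodule.mkQ_apply, Submodule.Quotient.mk_eq_zero]
  constructor
  · rintro ⟨s', hs', h⟩ t ht
    obtain ⟨u, hu, hsu⟩ := (Submodule.Quotient.eq _).1 h.symm
    have h1 : φ.onSec s.1 t = φ.onSec (s.1 - s'.1) t + φ.onSec s'.1 t := by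
      funext q
      simp [OrthogonalForm.onSec]
    rw [h1]
    refine Submodule.add_mem _ ⟨φ.onSec u t, hval u hu t ht, ?_⟩ (hs' t ht)
    filter_upwards [hsu] with y hy
    change (s.1 - s'.1) y = _ at hy
    simp only [OrthogonalForm.onSec, hy, map_smul, LinearMap.smul_apply]
  · intro h
    exact ⟨s, h, rfl⟩

theorem finrank_of_filtration {A Q U Y : Type*} [AddCommGroup A] [Module ℂ A] [AddCommGroup Q]
    [Module ℂ Q] [AddCommGroup U] [Module ℂ U] [AddCommGroup Y] [Module ℂ Y]
    [FiniteDimensional ℂ U] [FiniteDimensional ℂ Y] (e : A →ₗ[ℂ] Q)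
    (he : Function.Surjective e) (ρ : A →ₗ[ℂ] U) (hρ : Function.Surjective ρ)
    (hle : ∀ a, e a = 0 → ρ a = 0) (g : LinearMap.ker ρ →ₗ[ℂ] Y) (hg : Function.Surjective g)
    (hge : ∀ b, g b = 0 ↔ e b = 0) :
    FiniteDimensional ℂ Q ∧
      Module.finrank ℂ Q = Module.finrank ℂ U + Module.finrank ℂ Y := by
  obtain ⟨G, hG⟩ := LinearMap.exists_extend g
  have hG' : ∀ b : LinearMap.ker ρ, G b = g b := fun b => LinearMap.congr_fun hG b
  have hs : Function.Surjective (ρ.prod G) := by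
    rintro ⟨a, y⟩
    obtain ⟨a, rfl⟩ := hρ a
    obtain ⟨b, hb⟩ := hg (y - G a)
    refine ⟨a + b, Prod.ext ?_ ?_⟩
    · simp
    · simp [hG', hb]
  have hk : LinearMap.ker (ρ.prod G) = LinearMap.ker e := by
    ext a
    have hp : (ρ.prod G) a = (ρ a, G a) := rfl
    rw [LinearMap.mem_ker, LinearMap.mem_ker, hp, Prod.mk_eq_zero]
    constructor
    · rintro ⟨h1, h2⟩
      exact (hge ⟨a, h1⟩).1 ((hG' ⟨a, h1⟩).symm.trans h2)
    · intro h
      exact ⟨hle a h, (hG' ⟨a, hle a h⟩).trans ((hge ⟨a, hle a h⟩).2 h)⟩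
  have eq : (U × Y) ≃ₗ[ℂ] Q := (LinearMap.quotKerEquivOfSurjective _ hs).symm ≪≫ₗ
    Submodule.quotEquivOfEq _ _ hk ≪≫ₗ LinearMap.quotKerEquivOfSurjective e he
  exact ⟨Module.Finite.equiv eq, by rw [← eq.finrank_eq, Module.finrank_prod]⟩

variable [IsManifold 𝓘(ℂ) ω X]

theorem OrthogonalForm.onSec_mem_twist (φ : OrthogonalForm E L) {x : X}
    {U : Submodule ℂ (E.fiber x)} (hU : ∀ a ∈ U, ∀ b ∈ U, φ.form x a b = 0) {s t : Sec E}
    (hs : s ∈ heckeUp E x U.dualAnnihilator x) (ht : t ∈ heckeUp E x U.dualAnnihilator x) :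
    φ.onSec s t ∈ twist (holSheaf L) x x := by
  obtain ⟨u, hu, hux, hsu⟩ := mem_valuesIn.1 (mem_heckeUp_self.1 hs)
  obtain ⟨v, hv, hvx, htv⟩ := mem_valuesIn.1 (mem_heckeUp_self.1 ht)
  obtain ⟨w, hw, h⟩ := (φ.holSec_onSec hu hv).exists_eq_coord_smul (hU _ hux _ hvx)
  refine mem_twist_self.2 (mem_holSheaf.2 ⟨w, hw, ?_⟩)
  filter_upwards [hsu, htv, h.filter_mono nhdsWithin_le_nhds, eventually_coord_ne_zero x]
    with y h1 h2 h3 h4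
  apply smul_right_injective _ h4
  simp only [← h3]
  simp only [onSec, ← h1, ← h2, map_smul, LinearMap.smul_apply]

/-- If `φ(s, F)` consists of holomorphic germs then `s` is holomorphic. -/
theorem OrthogonalForm.mem_holSheaf_of_onSec (φ : OrthogonalForm E L) {x : X}
    {U : Submodule ℂ (E.fiber x)} {s : Sec E}
    (hs : s ∈ heckeUp E x U.dualAnnihilator x)
    (h : ∀ t ∈ heckeUp E x U.dualAnnihilator x, φ.onSec s t ∈ holSheaf L x) :
    s ∈ holSheaf E x := by
  obtain ⟨u, hu, hux, hsu⟩ := mem_valuesIn.1 (mem_heckeUp_self.1 hs)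
  have h0 : u x = 0 := by
    apply (φ.nondegenerate x).1
    rw [map_zero]
    ext b
    obtain ⟨v, hv, rfl⟩ := exists_holSec_eq x b
    obtain ⟨w, hw, hsw⟩ := mem_holSheaf.1 (h v (holSheaf_le_heckeUp hv.mem))
    have := (φ.holSec_onSec hu hv).eq_of_eventuallyEq (hw.smul (holFun_coord x)) (by
      filter_upwards [hsu, hsw] with y h1 h2
      rw [← h2]
      simp only [onSec, ← h1, map_smul, LinearMap.smul_apply])
    simpa [onSec] using this
  have := (mem_ker_residueMap (s := ⟨s, hs⟩)).1
  exact this ((residueMap_eq _ hu hsu).trans h0)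

theorem OrthogonalForm.onSec_heckeUp_iff (φ : OrthogonalForm E L) {x : X}
    {U : Submodule ℂ (E.fiber x)} {s : Sec E} (hs : s ∈ holSheaf E x) :
    (∀ t ∈ heckeUp E x U.dualAnnihilator x, φ.onSec s t ∈ holSheaf L x) ↔
      ∀ a ∈ U, φ.form x (germValue E x ⟨s, hs⟩) a = 0 := by
  obtain ⟨v, hv, hsv⟩ := mem_holSheaf.1 hs
  rw [germValue_eq hs hv hsv]
  constructor
  · intro h a ha
    obtain ⟨u, hu, rfl⟩ := exists_holSec_eq x a
    have hz : ∀ᶠ y in 𝓝[≠] x, coord x y • (coord x y)⁻¹ • u y = u y := by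
      filter_upwards [eventually_coord_ne_zero x] with y hy
      rw [smul_inv_smul₀ hy]
    obtain ⟨w, hw, hsw⟩ := mem_holSheaf.1 (h (fun y => (coord x y)⁻¹ • u y)
      (mem_heckeUp_self.2 (mem_valuesIn.2 ⟨u, hu, ha, hz⟩)))
    have := (φ.holSec_onSec hv hu).eq_of_eventuallyEq (hw.smul (holFun_coord x)) (by
      filter_upwards [hsv, hsw, hz] with y h1 h2 h3
      rw [← h2]
      simp only [onSec, h1]
      rw [← map_smul, h3])
    simpa [onSec] using this
  · intro h t ht
    obtain ⟨u, hu, hux, htu⟩ := mem_valuesIn.1 (mem_heckeUp_self.1 ht)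
    obtain ⟨w, hw, hvw⟩ := (φ.holSec_onSec hv hu).exists_eq_coord_smul (h _ hux)
    refine mem_holSheaf.2 ⟨w, hw, ?_⟩
    filter_upwards [hsv, htu, hvw.filter_mono nhdsWithin_le_nhds, eventually_coord_ne_zero x]
      with y h1 h2 h3 h4
    apply smul_right_injective _ h4
    simp only [← h3]
    simp only [onSec, h1, ← h2, map_smul]

theorem finrank_fiber_mod_radical (φ : OrthogonalForm E L) {x : X}
    {U : Submodule ℂ (E.fiber x)} (hU : ∀ a ∈ U, ∀ b ∈ U, φ.form x a b = 0) :
    FiniteDimensional ℂ (Fiber (heckeUp E x U.dualAnnihilator) x ⧸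
      radical φ (heckeUp E x U.dualAnnihilator) (twist (holSheaf L) x) x) ∧
    Module.finrank ℂ (Fiber (heckeUp E x U.dualAnnihilator) x ⧸
      radical φ (heckeUp E x U.dualAnnihilator) (twist (holSheaf L) x) x) =
      2 * Module.finrank ℂ U := by
  have hker : ∀ s : heckeUp E x U.dualAnnihilator x,
      evalModRadical φ (heckeUp E x U.dualAnnihilator) (twist (holSheaf L) x) x s = 0 ↔
        ∀ t ∈ heckeUp E x U.dualAnnihilator x, φ.onSec s.1 t ∈ holSheaf L x := fun s => by
    rw [evalModRadical_eq_zero_iff φ fun s hs t ht => φ.onSec_mem_twist hU hs ht,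
      vanishing_twist_holSheaf]
  let ρ := (residueMap x U).codRestrict U fun s =>
    range_residueMap.le (LinearMap.mem_range_self _ s)
  have hρ : Function.Surjective ρ := by
    rintro ⟨a, ha⟩
    obtain ⟨s, rfl⟩ := range_residueMap.ge ha
    exact ⟨s, rfl⟩
  have hρ0 : ∀ s, ρ s = 0 ↔ s.1 ∈ holSheaf E x := fun s => by
    rw [← mem_ker_residueMap, ← Submodule.coe_eq_zero]
    rfl
  let incl : LinearMap.ker ρ →ₗ[ℂ] holSheaf E x :=
    ((heckeUp E x U.dualAnnihilator x).subtype ∘ₗ (LinearMap.ker ρ).subtype).codRestrict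
      (holSheaf E x) fun s => (hρ0 s.1).1 s.2
  have hincl : Function.Surjective incl := by
    rintro ⟨s, hs⟩
    exact ⟨⟨⟨s, holSheaf_le_heckeUp hs⟩, (hρ0 _).2 hs⟩, rfl⟩
  let res : (E.fiber x →ₗ[ℂ] L.fiber x) →ₗ[ℂ] U →ₗ[ℂ] L.fiber x := LinearMap.lcomp ℂ _ U.subtype
  have hres : Function.Surjective res := fun f => LinearMap.exists_extend f
  let g : LinearMap.ker ρ →ₗ[ℂ] U →ₗ[ℂ] L.fiber x := res ∘ₗ φ.form x ∘ₗ germValue E x ∘ₗ incl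
  have hg : Function.Surjective g :=
    hres.comp ((φ.nondegenerate x).2.comp ((germValue_surjective x).comp hincl))
  obtain ⟨h1, h2⟩ := finrank_of_filtration _ (evalModRadical_surjective φ
    (heckeUp E x U.dualAnnihilator) (twist (holSheaf L) x) x) ρ hρ
    (fun s hs => (hρ0 s).2 (φ.mem_holSheaf_of_onSec s.2 ((hker s).1 hs))) g hg (fun b => by
      rw [hker, φ.onSec_heckeUp_iff ((hρ0 b.1).1 b.2), LinearMap.ext_iff]
      exact Subtype.forall)
  refine ⟨h1, ?_⟩
  rw [h2, Module.finrank_linearMap, finrank_fiber, mul_one, two_mul]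

theorem OrthogonalForm.nondegenerate_of_relOrd (φ : OrthogonalForm E L) {𝓖 : SubSheaf E} {p : X}
    {b e : Fin r → Sec E} (hb : ∀ i, HolSec E (b i) p) (β : Module.Basis (Fin r) ℂ (E.fiber p))
    (hβ : ∀ i, β i = b i p) (he : StalkFrame 𝓖 p e) (hrel : RelOrd p b e 0)
    (hval : ∀ s ∈ 𝓖 p, ∀ t ∈ 𝓖 p, φ.onSec s t ∈ holSheaf L p) {s : Sec E} (hs : s ∈ 𝓖 p)
    (h : ∀ t ∈ 𝓖 p, φ.onSec s t ∈ vanishing (holSheaf L) p) : s ∈ vanishing 𝓖 p := by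
  obtain ⟨N, l, c, hN, hp, hl⟩ := exists_dual_frames L p
  have hc : HolDualSec L (c 0) p := (hl p hp).2.2.2 0
  have hc0 : ∀ a : L.fiber p, c 0 p a = 0 → a = 0 := fun a ha => by
    rw [(hl p hp).2.1 a]
    simp [ha]
  let G : Fin r → Fin r → X → ℂ := fun i j y => c 0 y (φ.onSec (b i) (b j) y)
  have hG : ∀ i j, HolFun (G i j) p := fun i j => hc _ (φ.holSec_onSec (hb i) (hb j))
  have hGdet : (Matrix.of fun i j => G i j p).det ≠ 0 := by
    intro h0
    obtain ⟨v, hv, hvG⟩ := Matrix.exists_vecMul_eq_zero_iff.2 h0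
    apply hv
    have h1 : φ.form p (∑ i, v i • β i) = 0 := by
      refine β.ext fun j => hc0 _ ?_
      have := congrFun hvG j
      simp only [Matrix.vecMul, dotProduct, Matrix.of_apply, Pi.zero_apply] at this
      simpa [hβ, G, onSec] using this
    have h2 := (φ.nondegenerate p).1 (h1.trans (map_zero _).symm)
    exact funext (Fintype.linearIndependent_iff.1 β.linearIndependent v h2)
  choose w hw hew using fun i j => mem_holSheaf.1 (hval _ (he.mem i) _ (he.mem j))
  let g : Fin r → Fin r → X → ℂ := fun i j y => c 0 y (w i j y)
  have hg : ∀ i j, HolFun (g i j) p := fun i j => hc _ (hw i j)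
  obtain ⟨A, hA, heA, hdet⟩ := hrel
  have hgdet : ordFun (fun y => (Matrix.of fun i j => g i j y).det) p = 0 := by
    have h1 : ∀ᶠ y in 𝓝[≠] p, (Matrix.of fun i j => g i j y).det =
        (Matrix.of fun i j => A i j y).det * ((Matrix.of fun i j => G i j y).det *
          (Matrix.of fun i j => A i j y).det) := by
      filter_upwards [eventually_all.2 heA, eventually_all.2 fun i => eventually_all.2 (hew i)]
        with y h1 h2
      have h3 : (Matrix.of fun i j => g i j y) = (Matrix.of fun i j => A i j y) *
          ((Matrix.of fun i j => G i j y) * (Matrix.of fun i j => A i j y).transpose) := by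
        ext i j
        simp only [Matrix.of_apply, Matrix.mul_apply, Matrix.transpose_apply, g, G, ← h2, onSec,
          h1, map_sum, map_smul, LinearMap.sum_apply, LinearMap.smul_apply, smul_eq_mul,
          Finset.mul_sum]
        rw [Finset.sum_comm]
        exact Finset.sum_congr rfl fun a _ => Finset.sum_congr rfl fun b _ => by ring
      rw [h3, Matrix.det_mul, Matrix.det_mul, Matrix.det_transpose]
    rw [ordFun_congr h1, ordFun_mul (MeroFun.det hA) ((HolFun.det hG).meroFun.mul (MeroFun.det hA)),
      ordFun_mul (HolFun.det hG).meroFun (MeroFun.det hA), hdet,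
      (HolFun.det hG).ordFun_eq_zero hGdet]
    rfl
  have hgp := (HolFun.det hg).ne_zero_of_ordFun hgdet
  obtain ⟨f, hf, hsf⟩ := (he.2.2 s).1 hs
  refine (he.mem_vanishing_iff hf hsf).2 ?_
  have hfg : Matrix.vecMul (fun i => f i p) (Matrix.of fun i j => g i j p) = 0 := by
    funext j
    obtain ⟨a, ha, hsa⟩ := mem_vanishing.1 (h _ (he.mem j))
    obtain ⟨a', ha', haa⟩ := mem_holSheaf.1 ha
    have h1 : HolFun (fun y => ∑ i, f i y * g i j y) p :=
      HolFun.sum fun i _ => (hf i).mul (hg i j)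
    have := h1.eq_of_eventuallyEq ((holFun_coord p).mul (hc _ ha')) (by
      filter_upwards [hsf, hsa, haa, eventually_all.2 fun i => hew i j] with y h2 h3 h4 h5
      rw [h4] at h3
      have h6 := congrArg (c 0 y) h3
      rw [map_smul, smul_eq_mul] at h6
      rw [← h6]
      simp only [g, ← h5, onSec, h2, map_sum, map_smul, LinearMap.sum_apply, LinearMap.smul_apply,
        smul_eq_mul])
    simpa [Matrix.vecMul, dotProduct] using this
  intro i
  by_contra hne
  exact hgp (Matrix.exists_vecMul_eq_zero_iff.1 ⟨_, fun h0 => hne (congrFun h0 i), hfg⟩)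

end Forms


section SecondTransform

variable {X : Type u} [TopologicalSpace X] [ChartedSpace ℂ X] {r : ℕ}
  {E : HolVectorBundle.{u, v} X r} {L : HolVectorBundle.{u, w} X 1}

theorem heckeDown_eq_restrictAt (φ : OrthogonalForm E L) (𝓖 : SubSheaf E) (𝓛 : SubSheaf L) (x : X)
    (S : Submodule ℂ (Fiber 𝓖 x ⧸ radical φ 𝓖 𝓛 x)) :
    heckeDown φ 𝓖 𝓛 x S =
      restrictAt 𝓖 x ((S.comap (evalModRadical φ 𝓖 𝓛 x)).map (𝓖 x).subtype) := by
  funext p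
  rcases eq_or_ne p x with rfl | hp
  · rw [restrictAt_self, heckeDown, if_pos rfl, inf_eq_right.2 (Submodule.map_subtype_le _ _)]
  · rw [restrictAt_of_ne _ _ hp, heckeDown, if_neg hp]

theorem mem_heckeDown_self (φ : OrthogonalForm E L) {𝓖 : SubSheaf E} {𝓛 : SubSheaf L} {x : X}
    {S : Submodule ℂ (Fiber 𝓖 x ⧸ radical φ 𝓖 𝓛 x)} {s : Sec E} :
    s ∈ heckeDown φ 𝓖 𝓛 x S x ↔ ∃ h : s ∈ 𝓖 x, evalModRadical φ 𝓖 𝓛 x ⟨s, h⟩ ∈ S := by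
  rw [heckeDown, if_pos rfl]
  constructor
  · rintro ⟨⟨s, hs⟩, h, rfl⟩
    exact ⟨hs, h⟩
  · rintro ⟨hs, h⟩
    exact ⟨⟨s, hs⟩, h, rfl⟩

theorem heckeDown_of_ne (φ : OrthogonalForm E L) {𝓖 : SubSheaf E} {𝓛 : SubSheaf L} {x p : X}
    {S : Submodule ℂ (Fiber 𝓖 x ⧸ radical φ 𝓖 𝓛 x)} (hp : p ≠ x) :
    heckeDown φ 𝓖 𝓛 x S p = 𝓖 p := by rw [heckeDown, if_neg hp]

theorem OrthogonalForm.IsIsotropic.restrictAt {φ : OrthogonalForm E L} {𝓗 : SubSheaf E}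
    (h : φ.IsIsotropic 𝓗) (x : X) (P : Submodule ℂ (Sec E)) :
    φ.IsIsotropic (restrictAt 𝓗 x P) := by
  intro p s hs t ht
  rcases eq_or_ne p x with rfl | hp
  · rw [restrictAt_self] at hs ht
    exact h p s hs.1 t ht.1
  · rw [restrictAt_of_ne _ _ hp] at hs ht
    exact h p s hs t ht

theorem OrthogonalForm.IsIsotropic.twist {φ : OrthogonalForm E L} {𝓗 : SubSheaf E}
    (h : φ.IsIsotropic 𝓗) (x : X) : φ.IsIsotropic (twist 𝓗 x) := by
  intro p s hs t ht
  rcases eq_or_ne p x with rfl | hp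
  · filter_upwards [h p _ (mem_twist_self.1 hs) _ (mem_twist_self.1 ht),
      eventually_coord_ne_zero p] with y h1 h2
    simp only [onSec, map_smul, LinearMap.smul_apply, smul_eq_zero, h2, false_or] at h1
    exact h1
  · rw [twist_of_ne hp] at hs ht
    exact h p s hs t ht

theorem finrank_quotient_comap_le {V : Type*} [AddCommGroup V] [Module ℂ V]
    {A B P : Submodule ℂ V} (h : A ≤ B) [FiniteDimensional ℂ (B ⧸ P.comap B.subtype)] :
    Module.finrank ℂ (A ⧸ P.comap A.subtype) ≤ Module.finrank ℂ (B ⧸ P.comap B.subtype) := by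
  have hk : P.comap A.subtype =
      LinearMap.ker ((P.comap B.subtype).mkQ ∘ₗ Submodule.inclusion h) := by
    rw [LinearMap.ker_comp, Submodule.ker_mkQ, ← Submodule.comap_comp,
      Submodule.subtype_comp_inclusion]
  rw [hk, (LinearMap.quotKerEquivRange _).finrank_eq]
  exact Submodule.finrank_le _

variable [IsManifold 𝓘(ℂ) ω X]

theorem IsSubbundle.vanishing_le {𝓖 : SubSheaf E} {k : ℕ} (h : IsSubbundle 𝓖 𝓖 k) (p : X) :
    vanishing 𝓖 p ≤ 𝓖 p := by
  obtain ⟨m, e, e', he, -⟩ := h p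
  rintro s ⟨u, hu, hsu⟩
  obtain ⟨f, hf, huf⟩ := (he.stalkFrame.2.2 u).1 hu
  refine (he.stalkFrame.2.2 s).2 ⟨_, fun i => (holFun_coord p).mul (hf i), ?_⟩
  filter_upwards [hsu, huf] with y h1 h2
  rw [h1, h2, Finset.smul_sum]
  simp only [mul_smul]

theorem vanishing_le_heckeDown (φ : OrthogonalForm E L) {𝓖 : SubSheaf E} {k : ℕ}
    (h : IsSubbundle 𝓖 𝓖 k) {𝓛 : SubSheaf L} {x : X}
    (S : Submodule ℂ (Fiber 𝓖 x ⧸ radical φ 𝓖 𝓛 x)) :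
    vanishing 𝓖 x ≤ heckeDown φ 𝓖 𝓛 x S x := fun s hs =>
  (mem_heckeDown_self φ).2 ⟨h.vanishing_le x hs, by
    rw [evalModRadical_of_vanishing φ 𝓖 𝓛 hs]
    exact S.zero_mem⟩

theorem heckeDown_isSubbundle [T1Space X] (φ : OrthogonalForm E L) {𝓖 : SubSheaf E} {k : ℕ}
    (h : IsSubbundle 𝓖 𝓖 k) (𝓛 : SubSheaf L) {x : X}
    (S : Submodule ℂ (Fiber 𝓖 x ⧸ radical φ 𝓖 𝓛 x))
    [FiniteDimensional ℂ (Fiber 𝓖 x ⧸ radical φ 𝓖 𝓛 x)] :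
    IsSubbundle (heckeDown φ 𝓖 𝓛 x S) (heckeDown φ 𝓖 𝓛 x S) k ∧
      Shift x k 𝓖 (heckeDown φ 𝓖 𝓛 x S)
        (Module.finrank ℂ (Fiber 𝓖 x ⧸ radical φ 𝓖 𝓛 x) - Module.finrank ℂ S) := by
  have hP : vanishing 𝓖 x ≤ (S.comap (evalModRadical φ 𝓖 𝓛 x)).map (𝓖 x).subtype := by
    have := vanishing_le_heckeDown φ h S
    rwa [heckeDown, if_pos rfl] at this
  have hfin : Module.finrank ℂ (𝓖 x ⧸
      ((S.comap (evalModRadical φ 𝓖 𝓛 x)).map (𝓖 x).subtype).comap (𝓖 x).subtype) +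
        Module.finrank ℂ S = Module.finrank ℂ (Fiber 𝓖 x ⧸ radical φ 𝓖 𝓛 x) := by
    have h1 : ((S.comap (evalModRadical φ 𝓖 𝓛 x)).map (𝓖 x).subtype).comap (𝓖 x).subtype =
        LinearMap.ker (S.mkQ ∘ₗ evalModRadical φ 𝓖 𝓛 x) := by
      rw [Submodule.comap_map_eq_of_injective (Submodule.subtype_injective _),
        LinearMap.ker_comp, Submodule.ker_mkQ]
    have h2 : Function.Surjective (S.mkQ ∘ₗ evalModRadical φ 𝓖 𝓛 x) :=
      S.mkQ_surjective.comp (evalModRadical_surjective φ 𝓖 𝓛 x)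
    rw [h1, (LinearMap.quotKerEquivOfSurjective _ h2).finrank_eq,
      Submodule.finrank_quotient_add_finrank]
  rw [heckeDown_eq_restrictAt]
  obtain ⟨h3, h4⟩ := h.restrictAt hP
  refine ⟨h3, ?_⟩
  rwa [← hfin, Nat.cast_add, add_sub_cancel_right]

/-- The full Hecke correspondence does not change the determinant. -/
theorem shift_heckeDown_heckeUp [T1Space X] (φ : OrthogonalForm E L) {x : X}
    {U : Submodule ℂ (E.fiber x)} (hU : ∀ a ∈ U, ∀ b ∈ U, φ.form x a b = 0)
    (S : Submodule ℂ (Fiber (heckeUp E x U.dualAnnihilator) x ⧸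
      radical φ (heckeUp E x U.dualAnnihilator) (twist (holSheaf L) x) x))
    (hS : Module.finrank ℂ S = Module.finrank ℂ U) :
    IsSubbundle (heckeDown φ (heckeUp E x U.dualAnnihilator) (twist (holSheaf L) x) x S)
      (heckeDown φ (heckeUp E x U.dualAnnihilator) (twist (holSheaf L) x) x S) r ∧
    Shift x r (holSheaf E)
      (heckeDown φ (heckeUp E x U.dualAnnihilator) (twist (holSheaf L) x) x S) 0 := by
  obtain ⟨h1, h2⟩ := heckeUp_isSubbundle U
  obtain ⟨h3, h4⟩ := finrank_fiber_mod_radical φ hU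
  obtain ⟨h5, h6⟩ := heckeDown_isSubbundle φ h1 (twist (holSheaf L) x) S
  refine ⟨h5, ?_⟩
  have h7 := h2.trans h6
  rw [h4, hS] at h7
  push_cast at h7
  convert h7 using 1
  ring

theorem isOrthogonalBundle_heckeDown [T1Space X] (φ : OrthogonalForm E L) {x : X}
    {U : Submodule ℂ (E.fiber x)} (hU : ∀ a ∈ U, ∀ b ∈ U, φ.form x a b = 0)
    (S : Submodule ℂ (Fiber (heckeUp E x U.dualAnnihilator) x ⧸
      radical φ (heckeUp E x U.dualAnnihilator) (twist (holSheaf L) x) x))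
    (hSiso : IsIsotropicFiber φ (heckeUp E x U.dualAnnihilator) (twist (holSheaf L) x) x S)
    (hS : Module.finrank ℂ S = Module.finrank ℂ U) :
    φ.IsOrthogonalBundle
      (heckeDown φ (heckeUp E x U.dualAnnihilator) (twist (holSheaf L) x) x S) (holSheaf L) := by
  obtain ⟨h1, h2⟩ := shift_heckeDown_heckeUp φ hU S hS
  have hval : ∀ p, ∀ s ∈ heckeDown φ (heckeUp E x U.dualAnnihilator) (twist (holSheaf L) x) x S p,
      ∀ t ∈ heckeDown φ (heckeUp E x U.dualAnnihilator) (twist (holSheaf L) x) x S p,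
      φ.onSec s t ∈ holSheaf L p := by
    intro p s hs t ht
    rcases eq_or_ne p x with rfl | hp
    · obtain ⟨hs, hsS⟩ := (mem_heckeDown_self φ).1 hs
      obtain ⟨ht, htS⟩ := (mem_heckeDown_self φ).1 ht
      have := hSiso ⟨s, hs⟩ ⟨t, ht⟩ hsS htS
      rwa [vanishing_twist_holSheaf] at this
    · rw [heckeDown_of_ne φ hp, heckeUp_of_ne hp] at hs ht
      exact φ.onSec_mem_holSheaf hs ht
  refine ⟨isSubbundle_self.1 h1, hval, fun p s hs h => ?_⟩
  obtain ⟨b, hb, hbh, β, hβ⟩ := exists_isFrame_holSheaf E p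
  rcases eq_or_ne p x with rfl | hp
  · obtain ⟨-, e, e', he, he', hrel⟩ := h2
    refine φ.nondegenerate_of_relOrd hbh β hβ he'.stalkFrame ?_ (hval p) hs h
    simpa using (hb.stalkFrame.relOrd he.stalkFrame).trans hrel
  · have hb' : StalkFrame (heckeDown φ (heckeUp E x U.dualAnnihilator) (twist (holSheaf L) x) x S)
        p b := by
      rw [StalkFrame, heckeDown_of_ne φ hp, heckeUp_of_ne hp]
      exact hb.stalkFrame
    exact φ.nondegenerate_of_relOrd hbh β hβ hb' (hb'.relOrd hb') (hval p) hs h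

/-- An isotropic subbundle `𝓗` of the transform generates, over the meromorphic functions, an
isotropic subbundle of `E` whose degree is smaller by at most the dimension of `U`. -/
theorem exists_isotropic_subbundle_of_heckeDown [T1Space X] (φ : OrthogonalForm E L) {x : X}
    {U : Submodule ℂ (E.fiber x)} {F : SubSheaf E} (hFU : F = heckeUp E x U.dualAnnihilator)
    {𝓛 : SubSheaf L} {S : Submodule ℂ (Fiber F x ⧸ radical φ F 𝓛 x)}
    {j : ℕ} {𝓗 : SubSheaf E}
    (h𝓗 : IsSubbundle 𝓗 (heckeDown φ F 𝓛 x S) j)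
    (hiso : φ.IsIsotropic 𝓗) :
    ∃ 𝓗' : SubSheaf E, IsSubbundle 𝓗' (holSheaf E) j ∧ φ.IsIsotropic 𝓗' ∧
      degree 𝓗 j ≤ degree 𝓗' j + Module.finrank ℂ U := by
  have hF : IsSubbundle F F r := hFU ▸ (heckeUp_isSubbundle U).1
  have hFE : ∀ p, p ≠ x → F p = holSheaf E p := fun p hp => by
    rw [hFU, heckeUp_of_ne hp]
  have hle : heckeDown φ F 𝓛 x S x ≤ F x := fun s hs =>
    ((mem_heckeDown_self φ).1 hs).1
  have hvan := vanishing_le_heckeDown φ hF S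
  obtain ⟨h1, h2⟩ := h𝓗.restrictAt (vanishing_mono hle)
  obtain ⟨h3, h4⟩ := h1.twist x
  have eF : Hecke.twist (restrictAt (heckeDown φ F 𝓛 x S) x
      (vanishing F x)) x = F := by
    funext p
    rcases eq_or_ne p x with rfl | hp
    · ext s
      rw [mem_twist_self, restrictAt_self, inf_eq_right.2 hvan]
      constructor
      · rintro ⟨u, hu, hsu⟩
        obtain ⟨m, e, e', he, -⟩ := hF p
        refine he.stalkFrame.congr_mem hu ?_
        filter_upwards [hsu, eventually_coord_ne_zero p] with y h1 h2
        exact smul_right_injective _ h2 h1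
      · intro hs
        exact ⟨s, hs, Eventually.of_forall fun _ => rfl⟩
    · rw [twist_of_ne hp, restrictAt_of_ne _ _ hp, heckeDown_of_ne φ hp]
  rw [eF] at h3
  have hvE : vanishing F x ≤ holSheaf E x := by
    rintro s ⟨u, hu, hsu⟩
    rw [hFU] at hu
    exact holSheaf_congr (valuesIn_le (mem_heckeUp_self.1 hu)) hsu
  obtain ⟨h5, h6⟩ := h3.restrictAt hvE
  have eE : restrictAt F x (holSheaf E x) = holSheaf E := by
    funext p
    rcases eq_or_ne p x with rfl | hp
    · rw [restrictAt_self, inf_eq_right.2 (hFU ▸ holSheaf_le_heckeUp)]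
    · rw [restrictAt_of_ne _ _ hp, hFE p hp]
  rw [eE] at h5
  refine ⟨_, h5, ((hiso.restrictAt x _).twist x).restrictAt x _, ?_⟩
  have hd1 : Module.finrank ℂ (𝓗 x ⧸ (vanishing F x).comap (𝓗 x).subtype) ≤ j := by
    obtain ⟨m, e, e', he, -⟩ := h𝓗 x
    rw [← he.stalkFrame.finrank_quotient ((vanishing_mono (h𝓗.le x)).trans (vanishing_mono hle))]
    exact (Submodule.finrank_quotient_le _).trans (by simp)
  set 𝓗₁ := Hecke.twist (restrictAt 𝓗 x (vanishing F x)) x with h𝓗₁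
  have hd2 : Module.finrank ℂ (𝓗₁ x ⧸ (holSheaf E x).comap (𝓗₁ x).subtype) ≤
      Module.finrank ℂ U := by
    obtain ⟨hfd, hfin⟩ := finrank_heckeUp_quotient (E := E) U
    rw [← hFU] at hfd hfin
    rw [← hfin]
    exact finrank_quotient_comap_le (h3.le x)
  rcases ((h2.trans h4).trans h6).degree_eq with h7 | ⟨h7, h8⟩ <;> omega

theorem isStable_heckeDown [T1Space X] (φ : OrthogonalForm E L) {n : ℕ}
    (hE : φ.IsKLStable (holSheaf E) n n) {x : X}
    {U : Submodule ℂ (E.fiber x)} (hU : ∀ a ∈ U, ∀ b ∈ U, φ.form x a b = 0)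
    (hUn : Module.finrank ℂ U = n)
    (S : Submodule ℂ (Fiber (heckeUp E x U.dualAnnihilator) x ⧸
      radical φ (heckeUp E x U.dualAnnihilator) (twist (holSheaf L) x) x))
    (hS : Module.finrank ℂ S = n) :
    φ.IsStable (heckeDown φ (heckeUp E x U.dualAnnihilator) (twist (holSheaf L) x) x S) := by
  intro j 𝓗 hj h𝓗 hiso
  obtain ⟨𝓗', h1, h2, h3⟩ := exists_isotropic_subbundle_of_heckeDown φ rfl h𝓗 hiso
  have h4 := hE j 𝓗' hj h1 h2
  have h5 : degree (heckeDown φ (heckeUp E x U.dualAnnihilator) (twist (holSheaf L) x) x S) r =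
      degree (holSheaf E) r := by
    rcases (shift_heckeDown_heckeUp φ hU S (hS.trans hUn.symm)).2.degree_eq with h | h <;> omega
  rw [h5]
  rw [hUn] at h3
  rw [add_sub_cancel_right] at h4
  refine lt_of_le_of_lt ?_ h4
  have h6 : (degree 𝓗 j : ℚ) ≤ degree 𝓗' j + (n : ℤ) := by exact_mod_cast h3
  gcongr

end SecondTransform

end Hecke

theorem mainTheorem7 {X : Type u} [TopologicalSpace X] [T2Space X] [CompactSpace X]
    [ConnectedSpace X] [ChartedSpace ℂ X] [IsManifold 𝓘(ℂ) ω X]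
    (r n : ℕ) (hr : 3 ≤ r) (hn : n = r / 2)
    (E : HolVectorBundle.{u, v} X r) (L : HolVectorBundle.{u, w} X 1)
    (φ : Hecke.OrthogonalForm E L)
    (hE : φ.IsKLStable (Hecke.holSheaf E) n n)
    (x : X)
    (W : Submodule ℂ (Module.Dual ℂ (E.fiber x)))
    (hW : φ.IsIsotropicDual x W) (hWn : Module.finrank ℂ W = n)
    (F : Hecke.SubSheaf E) (hF : F = Hecke.heckeUp E x (φ.perp x W))
    (M : Hecke.SubSheaf L) (hM : M = Hecke.twist (Hecke.holSheaf L) x)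
    (S : Submodule ℂ (Hecke.Fiber F x ⧸ Hecke.radical φ F M x))
    (hS : Hecke.IsIsotropicFiber φ F M x S) (hSn : Module.finrank ℂ S = n) :
    φ.IsOrthogonalBundle (Hecke.heckeDown φ F M x S) (Hecke.holSheaf L) ∧
      φ.IsStable (Hecke.heckeDown φ F M x S) := by
  obtain ⟨U, hUW, hU, hperp⟩ := Hecke.exists_isotropic_of_dual φ hW
  rw [hperp] at hF
  subst hF hM
  have hUn := hUW.trans hWn
  exact ⟨Hecke.isOrthogonalBundle_heckeDown φ hU S hS (hSn.trans hUn.symm),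
    Hecke.isStable_heckeDown φ hE hU hUn S hSn⟩
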